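/- Let $K\ge 1$ and $\sigma>0$. For $\alpha\in\mathbb{R}$ let $g(\alpha)\in\mathbb{R}^{2K\times 2K}$ be the block-diagonal matrix whose $k$-th block ($k=1,\dots,K$) is $$\begin{pmatrix}\cos k\alpha & -\sin k\alpha\\ \sin k\alpha & \cos k\alpha\end{pmatrix}.$$ For $\theta=(\theta_{1,1},\theta_{1,2},\dots,\theta_{K,1},\theta_{K,2})\in\mathbb{R}^{2K}$ let $p_\theta$ be the density of $y=g(\alpha)\theta+\sigma\varepsilon$, where $\alpha\sim\mathrm{Unif}([-\pi,\pi))$ and $\varepsilon\sim\mathcal{N}(0,I_{2K})$ are independent, i.e. $$p_\theta(y)=\frac{1}{2\pi}\int_{-\pi}^{\pi}\frac{1}{(2\pi\sigma^2)^{K}}\exp\Big(-\frac{\|y-g(\alpha)\theta\|^2}{2\sigma^2}\Big)\,d\alpha ,$$ and let $D_{\mathrm{KL}}(p\|q)=\int p\log(p/q)$. Then for all $\theta,\theta'\in\mathbb{R}^{2K}$, $$D_{\mathrm{KL}}(p_\theta\|p_{\theta'})\le\frac{\|\theta-\theta'\|^2}{2\sigma^2}.$$ Furthermore, write $(\theta_{k,1},\theta_{k,2})=(r_k\cos\phi_k,r_k\sin\phi_k)$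 and $(\theta'_{k,1},\theta'_{k,2})=(r'_k\cos\phi'_k,r'_k\sin\phi'_k)$ with $r_k,r'_k\ge 0$ and $\phi_k,\phi'_k\in\mathbb{R}$ for $k=1,\dots,K$, and put $R^2=\max\big(\sum_{k=1}^K r_k^2,\sum_{k=1}^K {r'_k}^2\big)$ and $\bar r=\max\big(\max_k r_k,\max_k r'_k\big)$. Then also $$D_{\mathrm{KL}}(p_\theta\|p_{\theta'})\le\frac{e^{R^2/(2\sigma^2)}}{4\sigma^4}\sum_{k=1}^K\big(r_k^2-{r'_k}^2\big)^2+\frac{3\bar r^2R^2e^{3R^2/(2\sigma^2)}}{2\sigma^6}\cdot\inf_{\alpha\in\mathbb{R}}\sum_{k=1}^K\Big[(r_k-r'_k)^2+r_kr'_k\,(\phi_k-\phi'_k+k\alpha)^2\Big].$$ -/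

import Mathlib

open MeasureTheory InformationTheory

noncomputable section

/-- The rotation `θ ↦ g(α) · θ` of Fourier coefficients `θ ∈ ℝ^{2K}`. Coordinates are indexed by
`Fin K × Fin 2`; the index `i : Fin K` stands for the Fourier frequency `k = i + 1`, and
`θ (i, 0)`, `θ (i, 1)` are `θ_{k,1}`, `θ_{k,2}`. -/
def mraRot {K : ℕ} (α : ℝ) (θ : EuclideanSpace ℝ (Fin K × Fin 2)) :
    EuclideanSpace ℝ (Fin K × Fin 2) :=
  WithLp.toLp 2 fun p =>
    ![Real.cos (((p.1 : ℕ) + 1 : ℝ) * α) * θ (p.1, 0)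
        - Real.sin (((p.1 : ℕ) + 1 : ℝ) * α) * θ (p.1, 1),
      Real.sin (((p.1 : ℕ) + 1 : ℝ) * α) * θ (p.1, 0)
        + Real.cos (((p.1 : ℕ) + 1 : ℝ) * α) * θ (p.1, 1)] p.2

/-- The density `p_θ` on `ℝ^{2K}` of a sample `y = g(α) · θ + σ ε`, with `α` uniform on `[-π, π)`
and an independent standard Gaussian `ε ∈ ℝ^{2K}`: a Gaussian mixture over the rotations. -/
def mraDensity {K : ℕ} (σ : ℝ) (θ y : EuclideanSpace ℝ (Fin K × Fin 2)) : ℝ :=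
  (2 * Real.pi)⁻¹ * ∫ α in (-Real.pi)..Real.pi,
    ((2 * Real.pi * σ ^ 2) ^ K)⁻¹ * Real.exp (-‖y - mraRot α θ‖ ^ 2 / (2 * σ ^ 2))

/-- The distribution on `ℝ^{2K}` with Lebesgue density `p_θ`. -/
def mraLaw {K : ℕ} (σ : ℝ) (θ : EuclideanSpace ℝ (Fin K × Fin 2)) :
    Measure (EuclideanSpace ℝ (Fin K × Fin 2)) :=
  volume.withDensity fun y => ENNReal.ofReal (mraDensity σ θ y)

/-- `R² = max (∑ r_k², ∑ r'_k²)`. -/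
def maxEnergy {K : ℕ} (r r' : Fin K → ℝ) : ℝ :=
  max (∑ k, r k ^ 2) (∑ k, r' k ^ 2)

/-- `r̄ = max (max_k r_k, max_k r'_k)`. -/
def maxMagnitude {K : ℕ} (r r' : Fin K → ℝ) : ℝ :=
  max (⨆ k, r k) (⨆ k, r' k)

end

/-!
Write `X = g(α) θ` and `Y = g(α) θ'`, so that the two laws are Gaussian mixtures with centres `X`
and `Y`. Joint convexity of the divergence, applied with the same angle in both mixtures, gives the
first bound, since `‖X - Y‖ = ‖θ - θ'‖`.

For the second bound, `E Y = 0` and `exp t ≥ 1 + t` show that the density of `Y + σ ε` is at least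
`exp (-R² / 2σ²)` times that of `σ ε`. The divergence is therefore at most `exp (R² / 2σ²)` times
the squared distance between the two densities relative to the central Gaussian, which expands into
`∑ m, ‖E X^{⊗m} - E Y^{⊗m}‖² / (m! σ^{2m})`. In complex Fourier coordinates the rotation `g(α)` is
diagonal, so averaging over `α` kills every entry of a moment tensor except those whose frequencies
sum to zero. No entry survives for `m = 1`; for `m = 2` the pairs `{k, -k}` contribute
`∑ (r_k² - r'_k²)² / 4σ⁴`. For `m ≥ 3` the zero-sum constraint fixes one index given the others,
which replaces one factor `R²` by `r̄² / 2` and bounds the gap by a multiple of `‖θ - θ'‖²`.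
Finally, `p_θ` depends only on the orbit of `θ`, so one may first align `θ` with `θ'` by a rotation.
-/

noncomputable section

section KullbackLeibler

theorem klFun_add_log_mul_sub_le {x t : ℝ} (hx : 0 ≤ x) (ht : 0 < t) :
    klFun t + Real.log t * (x - t) ≤ klFun x := by
  rcases hx.eq_or_lt with rfl | hx
  · simp only [klFun_apply]
    linarith
  · have hlog := mul_le_mul_of_nonneg_left (Real.log_le_sub_one_of_pos (div_pos ht hx)) hx.le
    rw [Real.log_div ht.ne' hx.ne', mul_sub_one, mul_div_cancel₀ _ hx.ne'] at hlog
    simp only [klFun_apply]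
    linarith

theorem klFun_le_sub_one_sq {x : ℝ} (hx : 0 ≤ x) : klFun x ≤ (x - 1) ^ 2 := by
  rcases hx.eq_or_lt with rfl | hx
  · simp [klFun_apply]
  · have hlog := mul_le_mul_of_nonneg_left (Real.log_le_sub_one_of_pos hx) hx.le
    rw [klFun_apply]
    linarith

theorem integral_pos_of_forall_pos {Ω : Type*} [MeasurableSpace Ω] {μ : Measure Ω} [NeZero μ]
    {f : Ω → ℝ} (hf : Integrable f μ) (hf₀ : ∀ ω, 0 < f ω) : 0 < ∫ ω, f ω ∂μ := by
  have hsupp : Function.support f = Set.univ := Set.eq_univ_of_forall fun ω => (hf₀ ω).ne'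
  rw [integral_pos_iff_support_of_nonneg (fun ω => (hf₀ ω).le) hf, hsupp]
  exact Measure.measure_univ_pos.2 (NeZero.ne μ)

/- The tangent line of `klFun` at the ratio `P / Q` of the two integrals, scaled by `q`, bounds the
integrand from below, and its correction term integrates to zero. -/
theorem mul_klFun_integral_div_le {Ω : Type*} [MeasurableSpace Ω] {μ : Measure Ω} [NeZero μ]
    {p q : Ω → ℝ} (hp : Integrable p μ) (hq : Integrable q μ)
    (hp₀ : ∀ ω, 0 < p ω) (hq₀ : ∀ ω, 0 < q ω)
    (hpq : Integrable (fun ω => q ω * klFun (p ω / q ω)) μ) :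
    (∫ ω, q ω ∂μ) * klFun ((∫ ω, p ω ∂μ) / ∫ ω, q ω ∂μ) ≤ ∫ ω, q ω * klFun (p ω / q ω) ∂μ := by
  have hP := integral_pos_of_forall_pos hp hp₀
  have hQ := integral_pos_of_forall_pos hq hq₀
  set P := ∫ ω, p ω ∂μ
  set Q := ∫ ω, q ω ∂μ
  have hdev : Integrable (fun ω => p ω - P / Q * q ω) μ := hp.sub (hq.const_mul _)
  have hdev₀ : ∫ ω, (p ω - P / Q * q ω) ∂μ = 0 := by
    rw [integral_sub hp (hq.const_mul _), integral_const_mul, div_mul_cancel₀ _ hQ.ne', sub_self]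
  calc Q * klFun (P / Q)
      = ∫ ω, (klFun (P / Q) * q ω + Real.log (P / Q) * (p ω - P / Q * q ω)) ∂μ := by
        rw [integral_add (hq.const_mul _) (hdev.const_mul _), integral_const_mul,
          integral_const_mul, hdev₀, mul_zero, add_zero, mul_comm]
    _ ≤ ∫ ω, q ω * klFun (p ω / q ω) ∂μ := by
        refine integral_mono ((hq.const_mul _).add (hdev.const_mul _)) hpq fun ω => ?_
        have htangent := mul_le_mul_of_nonneg_left (klFun_add_log_mul_sub_le
          (div_pos (hp₀ ω) (hq₀ ω)).le (div_pos hP hQ)) (hq₀ ω).le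
        refine le_of_eq_of_le ?_ htangent
        have := (hq₀ ω).ne'
        field_simp

theorem ofReal_mul_klFun_integral_div_le {Ω : Type*} [MeasurableSpace Ω] {μ : Measure Ω}
    [NeZero μ] {p q : Ω → ℝ} (hp : Integrable p μ) (hq : Integrable q μ)
    (hp₀ : ∀ ω, 0 < p ω) (hq₀ : ∀ ω, 0 < q ω) :
    ENNReal.ofReal ((∫ ω, q ω ∂μ) * klFun ((∫ ω, p ω ∂μ) / ∫ ω, q ω ∂μ))
      ≤ ∫⁻ ω, ENNReal.ofReal (q ω * klFun (p ω / q ω)) ∂μ := by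
  have hnn : ∀ ω, 0 ≤ q ω * klFun (p ω / q ω) := fun ω =>
    mul_nonneg (hq₀ ω).le (klFun_nonneg (div_pos (hp₀ ω) (hq₀ ω)).le)
  have hmeas : AEStronglyMeasurable (fun ω => q ω * klFun (p ω / q ω)) μ :=
    (hq.aemeasurable.mul (measurable_klFun.comp_aemeasurable
      (hp.aemeasurable.div hq.aemeasurable))).aestronglyMeasurable
  by_cases hpq : Integrable (fun ω => q ω * klFun (p ω / q ω)) μ
  · rw [← ofReal_integral_eq_lintegral_ofReal hpq (ae_of_all _ hnn)]
    exact ENNReal.ofReal_le_ofReal (mul_klFun_integral_div_le hp hq hp₀ hq₀ hpq)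
  · rw [← lintegral_ofReal_ne_top_iff_integrable hmeas (ae_of_all _ hnn), not_not] at hpq
    exact hpq ▸ le_top

variable {X : Type*} [MeasurableSpace X] {m : Measure X}

theorem klDiv_withDensity_ofReal {p q : X → ℝ} (hp : Measurable p) (hq : Measurable q)
    (hp₀ : ∀ x, 0 ≤ p x) (hq₀ : ∀ x, 0 < q x)
    [IsFiniteMeasure (m.withDensity fun x => ENNReal.ofReal (p x))]
    [IsFiniteMeasure (m.withDensity fun x => ENNReal.ofReal (q x))] :
    klDiv (m.withDensity fun x => ENNReal.ofReal (p x))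
        (m.withDensity fun x => ENNReal.ofReal (q x))
      = ∫⁻ x, ENNReal.ofReal (q x * klFun (p x / q x)) ∂m := by
  set ν := m.withDensity fun x => ENNReal.ofReal (q x) with hν
  have hratio : Measurable fun x => ENNReal.ofReal (p x / q x) := (hp.div hq).ennreal_ofReal
  have hdensity : (m.withDensity fun x => ENNReal.ofReal (p x))
      = ν.withDensity fun x => ENNReal.ofReal (p x / q x) := by
    rw [hν, ← withDensity_mul m hq.ennreal_ofReal hratio]
    refine congrArg m.withDensity (funext fun x => ?_)
    rw [Pi.mul_apply, ← ENNReal.ofReal_mul (hq₀ x).le, mul_div_cancel₀ _ (hq₀ x).ne']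
  rw [klDiv_eq_lintegral_klFun_of_ac (hdensity ▸ withDensity_absolutelyContinuous _ _)]
  calc ∫⁻ x, ENNReal.ofReal
        (klFun ((m.withDensity fun x => ENNReal.ofReal (p x)).rnDeriv ν x).toReal) ∂ν
      = ∫⁻ x, ENNReal.ofReal (klFun (p x / q x)) ∂ν := by
        have hrn := Measure.rnDeriv_withDensity ν hratio
        rw [← hdensity] at hrn
        refine lintegral_congr_ae ?_
        filter_upwards [hrn] with x hx
        rw [hx, ENNReal.toReal_ofReal (div_nonneg (hp₀ x) (hq₀ x).le)]
    _ = ∫⁻ x, ENNReal.ofReal (q x * klFun (p x / q x)) ∂m := by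
        have hkl : Measurable fun x => ENNReal.ofReal (klFun (p x / q x)) :=
          (measurable_klFun.comp (hp.div hq)).ennreal_ofReal
        rw [hν, lintegral_withDensity_eq_lintegral_mul _ hq.ennreal_ofReal hkl]
        simp only [Pi.mul_apply, ENNReal.ofReal_mul (hq₀ _).le]

theorem klDiv_withDensity_le_ofReal_mul_integral {p q g : X → ℝ} {c : ℝ} (hp : Measurable p)
    (hq : Measurable q) (hp₀ : ∀ x, 0 ≤ p x) (hq₀ : ∀ x, 0 < q x) (hg₀ : ∀ x, 0 < g x)
    (hgq : ∀ x, g x ≤ c * q x) (hint : Integrable (fun x => (p x - q x) ^ 2 / g x) m)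
    [IsFiniteMeasure (m.withDensity fun x => ENNReal.ofReal (p x))]
    [IsFiniteMeasure (m.withDensity fun x => ENNReal.ofReal (q x))] :
    klDiv (m.withDensity fun x => ENNReal.ofReal (p x))
        (m.withDensity fun x => ENNReal.ofReal (q x))
      ≤ ENNReal.ofReal (c * ∫ x, (p x - q x) ^ 2 / g x ∂m) := by
  have hle (x : X) : q x * klFun (p x / q x) ≤ c * ((p x - q x) ^ 2 / g x) := by
    have := (hq₀ x).ne'
    calc q x * klFun (p x / q x) ≤ q x * (p x / q x - 1) ^ 2 :=
          mul_le_mul_of_nonneg_left (klFun_le_sub_one_sq (div_nonneg (hp₀ x) (hq₀ x).le))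
            (hq₀ x).le
      _ = (p x - q x) ^ 2 / q x := by field_simp
      _ ≤ c * ((p x - q x) ^ 2 / g x) := by
          rw [← mul_div_assoc, div_le_div_iff₀ (hq₀ x) (hg₀ x), mul_comm c, mul_assoc]
          exact mul_le_mul_of_nonneg_left (hgq x) (sq_nonneg _)
  rw [klDiv_withDensity_ofReal hp hq hp₀ hq₀, ← integral_const_mul,
    ofReal_integral_eq_lintegral_ofReal (hint.const_mul c) (ae_of_all _ fun x =>
      (mul_nonneg (hq₀ x).le (klFun_nonneg (div_nonneg (hp₀ x) (hq₀ x).le))).trans (hle x))]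
  exact lintegral_mono fun x => ENNReal.ofReal_le_ofReal (hle x)

variable {Ω : Type*} [MeasurableSpace Ω] {μ : Measure Ω}

theorem measurable_integral_of_uncurry [SFinite μ] {p : Ω → X → ℝ}
    (hp : Measurable (Function.uncurry p)) :
    Measurable fun x => ∫ ω, p ω x ∂μ :=
  hp.stronglyMeasurable.integral_prod_left.measurable

variable [IsProbabilityMeasure μ]

theorem isProbabilityMeasure_withDensity_integral [SFinite m] {p : Ω → X → ℝ}
    (hp : Measurable (Function.uncurry p)) (hp₀ : ∀ ω x, 0 ≤ p ω x)
    (hpi : ∀ x, Integrable (fun ω => p ω x) μ)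
    [hpm : ∀ ω, IsProbabilityMeasure (m.withDensity fun x => ENNReal.ofReal (p ω x))] :
    IsProbabilityMeasure (m.withDensity fun x => ENNReal.ofReal (∫ ω, p ω x ∂μ)) := by
  have hmass (ω : Ω) : ∫⁻ x, ENNReal.ofReal (p ω x) ∂m = 1 := by
    have huniv := (hpm ω).measure_univ
    rwa [withDensity_apply _ MeasurableSet.univ, Measure.restrict_univ] at huniv
  constructor
  rw [withDensity_apply _ MeasurableSet.univ, Measure.restrict_univ]
  simp_rw [ofReal_integral_eq_lintegral_ofReal (hpi _) (ae_of_all _ fun ω => hp₀ ω _)]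
  rw [lintegral_lintegral_swap (hp.comp measurable_swap).ennreal_ofReal.aemeasurable]
  simp [hmass]

theorem klDiv_withDensity_integral_le [SFinite m] {p q : Ω → X → ℝ}
    (hp : Measurable (Function.uncurry p)) (hq : Measurable (Function.uncurry q))
    (hp₀ : ∀ ω x, 0 < p ω x) (hq₀ : ∀ ω x, 0 < q ω x)
    (hpi : ∀ x, Integrable (fun ω => p ω x) μ) (hqi : ∀ x, Integrable (fun ω => q ω x) μ)
    [∀ ω, IsProbabilityMeasure (m.withDensity fun x => ENNReal.ofReal (p ω x))]
    [∀ ω, IsProbabilityMeasure (m.withDensity fun x => ENNReal.ofReal (q ω x))] :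
    klDiv (m.withDensity fun x => ENNReal.ofReal (∫ ω, p ω x ∂μ))
        (m.withDensity fun x => ENNReal.ofReal (∫ ω, q ω x ∂μ))
      ≤ ∫⁻ ω, klDiv (m.withDensity fun x => ENNReal.ofReal (p ω x))
          (m.withDensity fun x => ENNReal.ofReal (q ω x)) ∂μ := by
  have := isProbabilityMeasure_withDensity_integral (m := m) hp (fun ω x => (hp₀ ω x).le) hpi
  have := isProbabilityMeasure_withDensity_integral (m := m) hq (fun ω x => (hq₀ ω x).le) hqi
  have hmeas : Measurable fun z : X × Ω =>
      ENNReal.ofReal (q z.2 z.1 * klFun (p z.2 z.1 / q z.2 z.1)) :=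
    ((hq.mul (measurable_klFun.comp (hp.div hq))).comp measurable_swap).ennreal_ofReal
  calc klDiv (m.withDensity fun x => ENNReal.ofReal (∫ ω, p ω x ∂μ))
        (m.withDensity fun x => ENNReal.ofReal (∫ ω, q ω x ∂μ))
      = ∫⁻ x, ENNReal.ofReal
          ((∫ ω, q ω x ∂μ) * klFun ((∫ ω, p ω x ∂μ) / ∫ ω, q ω x ∂μ)) ∂m :=
        klDiv_withDensity_ofReal (measurable_integral_of_uncurry hp)
          (measurable_integral_of_uncurry hq)
          (fun x => (integral_pos_of_forall_pos (hpi x) fun ω => hp₀ ω x).le)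
          (fun x => integral_pos_of_forall_pos (hqi x) fun ω => hq₀ ω x)
    _ ≤ ∫⁻ x, ∫⁻ ω, ENNReal.ofReal (q ω x * klFun (p ω x / q ω x)) ∂μ ∂m :=
        lintegral_mono fun x => ofReal_mul_klFun_integral_div_le (hpi x) (hqi x)
          (fun ω => hp₀ ω x) (fun ω => hq₀ ω x)
    _ = ∫⁻ ω, ∫⁻ x, ENNReal.ofReal (q ω x * klFun (p ω x / q ω x)) ∂m ∂μ :=
        lintegral_lintegral_swap hmeas.aemeasurable
    _ = ∫⁻ ω, klDiv (m.withDensity fun x => ENNReal.ofReal (p ω x))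
          (m.withDensity fun x => ENNReal.ofReal (q ω x)) ∂μ :=
        lintegral_congr fun ω => (klDiv_withDensity_ofReal hp.of_uncurry_left
          hq.of_uncurry_left (fun x => (hp₀ ω x).le) (hq₀ ω)).symm

end KullbackLeibler

section IsotropicGaussian

variable {V : Type*} [NormedAddCommGroup V] [InnerProductSpace ℝ V]

/-- The Lebesgue density of the Gaussian law `𝒩(a, σ² I)` on a Euclidean space `V`. The exponent
`dim V / 2` is a real number, so that odd dimensions are allowed. -/
def isotropicGaussianPDF (σ : ℝ) (a y : V) : ℝ :=
  ((2 * Real.pi * σ ^ 2) ^ (Module.finrank ℝ V / 2 : ℝ))⁻¹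
    * Real.exp (-‖y - a‖ ^ 2 / (2 * σ ^ 2))

variable {σ : ℝ}

theorem isotropicGaussianPDF_pos (hσ : 0 < σ) (a y : V) : 0 < isotropicGaussianPDF σ a y := by
  unfold isotropicGaussianPDF
  positivity

theorem continuous_isotropicGaussianPDF (σ : ℝ) :
    Continuous fun z : V × V => isotropicGaussianPDF σ z.1 z.2 := by
  unfold isotropicGaussianPDF
  fun_prop

theorem isotropicGaussianPDF_le (σ : ℝ) (a y : V) :
    isotropicGaussianPDF σ a y ≤ ((2 * Real.pi * σ ^ 2) ^ (Module.finrank ℝ V / 2 : ℝ))⁻¹ := by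
  refine mul_le_of_le_one_right (by positivity) (Real.exp_le_one_iff.2 ?_)
  exact div_nonpos_of_nonpos_of_nonneg (neg_nonpos.2 (sq_nonneg _)) (by positivity)

theorem isotropicGaussianPDF_zero_sub (σ : ℝ) (a y : V) :
    isotropicGaussianPDF σ 0 (y - a) = isotropicGaussianPDF σ a y := by
  simp only [isotropicGaussianPDF, sub_zero]

theorem isotropicGaussianPDF_zero_neg (σ : ℝ) (y : V) :
    isotropicGaussianPDF σ 0 (-y) = isotropicGaussianPDF σ 0 y := by
  simp only [isotropicGaussianPDF, sub_zero, norm_neg]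

theorem isotropicGaussianPDF_eq_mul_exp_inner (hσ : 0 < σ) (a y : V) :
    isotropicGaussianPDF σ a y = Real.exp (-‖a‖ ^ 2 / (2 * σ ^ 2))
      * (isotropicGaussianPDF σ 0 y * Real.exp (inner ℝ a y / σ ^ 2)) := by
  have hexp : -‖y - a‖ ^ 2 / (2 * σ ^ 2)
      = -‖a‖ ^ 2 / (2 * σ ^ 2) + (-‖y - 0‖ ^ 2 / (2 * σ ^ 2) + inner ℝ a y / σ ^ 2) := by
    rw [norm_sub_sq_real, sub_zero, real_inner_comm]
    field_simp
    ring
  rw [isotropicGaussianPDF, isotropicGaussianPDF, hexp, Real.exp_add, Real.exp_add]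
  ring

theorem isotropicGaussianPDF_zero_mul_exp_inner (hσ : 0 < σ) (w y : V) :
    isotropicGaussianPDF σ 0 y * Real.exp (inner ℝ w y)
      = Real.exp (σ ^ 2 * ‖w‖ ^ 2 / 2) * isotropicGaussianPDF σ (σ ^ 2 • w) y := by
  have := hσ.ne'
  rw [isotropicGaussianPDF_eq_mul_exp_inner hσ (σ ^ 2 • w), ← mul_assoc, ← Real.exp_add,
    norm_smul, real_inner_smul_left, mul_div_cancel_left₀ _ (by positivity), Real.norm_eq_abs,
    mul_pow, sq_abs]
  field_simp
  simp

theorem isotropicGaussianPDF_mul_div (hσ : 0 < σ) (a b y : V) :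
    isotropicGaussianPDF σ a y * isotropicGaussianPDF σ b y / isotropicGaussianPDF σ 0 y
      = Real.exp (inner ℝ a b / σ ^ 2) * isotropicGaussianPDF σ (a + b) y := by
  have hexp : Real.exp (inner ℝ a b / σ ^ 2) * Real.exp (-‖a + b‖ ^ 2 / (2 * σ ^ 2))
      = Real.exp (-‖a‖ ^ 2 / (2 * σ ^ 2)) * Real.exp (-‖b‖ ^ 2 / (2 * σ ^ 2)) := by
    rw [← Real.exp_add, ← Real.exp_add, norm_add_sq_real]
    congr 1
    field_simp
    ring
  rw [div_eq_iff (isotropicGaussianPDF_pos hσ 0 y).ne', isotropicGaussianPDF_eq_mul_exp_inner hσ a,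
    isotropicGaussianPDF_eq_mul_exp_inner hσ b, isotropicGaussianPDF_eq_mul_exp_inner hσ (a + b),
    inner_add_left, add_div, Real.exp_add, ← mul_assoc (Real.exp (inner ℝ a b / σ ^ 2)), hexp]
  ring

theorem log_isotropicGaussianPDF_div (hσ : 0 < σ) (a b y : V) :
    Real.log (isotropicGaussianPDF σ a y / isotropicGaussianPDF σ b y)
      = ‖a - b‖ ^ 2 / (2 * σ ^ 2) + inner ℝ (a - b) (y - a) / σ ^ 2 := by
  have hsplit : y - b = (y - a) + (a - b) := by abel
  rw [isotropicGaussianPDF, isotropicGaussianPDF, mul_div_mul_left _ _ (by positivity),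
    ← Real.exp_sub, Real.log_exp, hsplit, norm_add_sq_real, real_inner_comm (y - a)]
  field_simp
  ring

variable [FiniteDimensional ℝ V] [MeasurableSpace V] [BorelSpace V]

theorem integral_isotropicGaussianPDF (hσ : 0 < σ) (a : V) :
    ∫ y, isotropicGaussianPDF σ a y = 1 := by
  have hb : 0 < (2 * σ ^ 2)⁻¹ := by positivity
  have hexp (y : V) : -‖y‖ ^ 2 / (2 * σ ^ 2) = -(2 * σ ^ 2)⁻¹ * ‖y‖ ^ 2 := by field_simp
  have hvar : Real.pi / (2 * σ ^ 2)⁻¹ = 2 * Real.pi * σ ^ 2 := by rw [div_inv_eq_mul]; ring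
  simp_rw [← isotropicGaussianPDF_zero_sub σ a]
  rw [integral_sub_right_eq_self (isotropicGaussianPDF σ 0) a]
  simp only [isotropicGaussianPDF, sub_zero, hexp]
  rw [integral_const_mul, GaussianFourier.integral_rexp_neg_mul_sq_norm hb, hvar]
  exact inv_mul_cancel₀ (by positivity)

theorem integrable_isotropicGaussianPDF (hσ : 0 < σ) (a : V) :
    Integrable (isotropicGaussianPDF σ a) :=
  integrable_of_integral_eq_one (integral_isotropicGaussianPDF hσ a)

theorem isProbabilityMeasure_isotropicGaussian (hσ : 0 < σ) (a : V) :
    IsProbabilityMeasure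
      (volume.withDensity fun y => ENNReal.ofReal (isotropicGaussianPDF σ a y)) := by
  constructor
  rw [withDensity_apply _ MeasurableSet.univ, Measure.restrict_univ,
    ← ofReal_integral_eq_lintegral_ofReal (integrable_isotropicGaussianPDF hσ a)
      (ae_of_all _ fun y => (isotropicGaussianPDF_pos hσ a y).le),
    integral_isotropicGaussianPDF hσ, ENNReal.ofReal_one]

theorem integrable_isotropicGaussianPDF_mul_inner_sub (hσ : 0 < σ) (a w : V) :
    Integrable fun y => isotropicGaussianPDF σ a y * inner ℝ w (y - a) := by
  have hcentred : Integrable fun y => isotropicGaussianPDF σ 0 y * inner ℝ w y := by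
    have htilt (v : V) :
        Integrable fun y => isotropicGaussianPDF σ 0 y * Real.exp (inner ℝ v y) := by
      simp only [isotropicGaussianPDF_zero_mul_exp_inner hσ]
      exact (integrable_isotropicGaussianPDF hσ _).const_mul _
    refine ((htilt w).add (htilt (-w))).mono' (Continuous.aestronglyMeasurable ?_)
      (ae_of_all _ fun y => ?_)
    · have := continuous_isotropicGaussianPDF (V := V) σ
      fun_prop
    have habs : |(inner ℝ w y : ℝ)| ≤ Real.exp (inner ℝ w y) + Real.exp (inner ℝ (-w) y) := by
      rw [inner_neg_left]
      exact (le_add_of_nonneg_right zero_le_one).trans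
        ((Real.add_one_le_exp _).trans (Real.exp_abs_le _))
    rw [Pi.add_apply, norm_mul, Real.norm_of_nonneg (isotropicGaussianPDF_pos hσ 0 y).le,
      Real.norm_eq_abs, ← mul_add]
    exact mul_le_mul_of_nonneg_left habs (isotropicGaussianPDF_pos hσ 0 y).le
  simpa only [isotropicGaussianPDF_zero_sub] using hcentred.comp_sub_right a

theorem integral_isotropicGaussianPDF_mul_inner_sub (σ : ℝ) (a w : V) :
    ∫ y, isotropicGaussianPDF σ a y * inner ℝ w (y - a) = 0 := by
  have hodd : ∫ y, isotropicGaussianPDF σ 0 y * inner ℝ w y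
      = -∫ y, isotropicGaussianPDF σ 0 y * inner ℝ w y := by
    conv_lhs => rw [← integral_neg_eq_self]
    simp only [isotropicGaussianPDF_zero_neg, inner_neg_right, mul_neg, integral_neg]
  simp_rw [← isotropicGaussianPDF_zero_sub σ a]
  rw [integral_sub_right_eq_self (fun y => isotropicGaussianPDF σ 0 y * inner ℝ w y) a]
  exact self_eq_neg.1 hodd

theorem klDiv_isotropicGaussian (hσ : 0 < σ) (a b : V) :
    klDiv (volume.withDensity fun y => ENNReal.ofReal (isotropicGaussianPDF σ a y))
        (volume.withDensity fun y => ENNReal.ofReal (isotropicGaussianPDF σ b y))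
      = ENNReal.ofReal (‖a - b‖ ^ 2 / (2 * σ ^ 2)) := by
  have := isProbabilityMeasure_isotropicGaussian hσ a
  have := isProbabilityMeasure_isotropicGaussian hσ b
  have hmeas (c : V) : Measurable (isotropicGaussianPDF σ c) :=
    ((continuous_isotropicGaussianPDF σ).comp (by fun_prop : Continuous fun y => (c, y))).measurable
  have hkl : (fun y => isotropicGaussianPDF σ b y
        * klFun (isotropicGaussianPDF σ a y / isotropicGaussianPDF σ b y))
      = (fun y => ‖a - b‖ ^ 2 / (2 * σ ^ 2) * isotropicGaussianPDF σ a y)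
        + (fun y => (σ ^ 2)⁻¹ * (isotropicGaussianPDF σ a y * inner ℝ (a - b) (y - a)))
        + (isotropicGaussianPDF σ b - isotropicGaussianPDF σ a) := by
    funext y
    have := (isotropicGaussianPDF_pos hσ b y).ne'
    rw [klFun_apply, log_isotropicGaussianPDF_div hσ]
    simp only [Pi.add_apply, Pi.sub_apply]
    field_simp
    ring
  have ha := integrable_isotropicGaussianPDF hσ a
  have hb := integrable_isotropicGaussianPDF hσ b
  have hquad := ha.const_mul (‖a - b‖ ^ 2 / (2 * σ ^ 2))
  have hlin := (integrable_isotropicGaussianPDF_mul_inner_sub hσ a (a - b)).const_mul (σ ^ 2)⁻¹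
  rw [klDiv_withDensity_ofReal (hmeas a) (hmeas b) (fun y => (isotropicGaussianPDF_pos hσ a y).le)
      (isotropicGaussianPDF_pos hσ b),
    ← ofReal_integral_eq_lintegral_ofReal (hkl ▸ (hquad.add hlin).add (hb.sub ha))
      (ae_of_all _ fun y => mul_nonneg (isotropicGaussianPDF_pos hσ b y).le (klFun_nonneg
        (div_pos (isotropicGaussianPDF_pos hσ a y) (isotropicGaussianPDF_pos hσ b y)).le)),
    hkl, integral_add' (hquad.add hlin) (hb.sub ha), integral_add' hquad hlin, integral_sub' hb ha,
    integral_const_mul, integral_const_mul, integral_isotropicGaussianPDF_mul_inner_sub,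
    integral_isotropicGaussianPDF hσ, integral_isotropicGaussianPDF hσ, mul_one, mul_zero,
    sub_self, add_zero, add_zero]

end IsotropicGaussian

section GaussianMixture

variable {V : Type*} [NormedAddCommGroup V] [InnerProductSpace ℝ V] {Ω : Type*}
  [MeasurableSpace Ω]

theorem abs_inner_le_sq {x y : V} {R : ℝ} (hx : ‖x‖ ≤ R) (hy : ‖y‖ ≤ R) :
    |(inner ℝ x y : ℝ)| ≤ R ^ 2 :=
  (abs_real_inner_le_norm x y).trans
    ((mul_le_mul hx hy (norm_nonneg _) ((norm_nonneg _).trans hx)).trans_eq (sq R).symm)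

/-- The Lebesgue density of `X + σ ε`, where `X` is a random vector under `μ` and `ε` is an
independent standard Gaussian vector. -/
def gaussianMixturePDF (μ : Measure Ω) (σ : ℝ) (X : Ω → V) (y : V) : ℝ :=
  ∫ ω, isotropicGaussianPDF σ (X ω) y ∂μ

theorem gaussianMixturePDF_mul_div {μ : Measure Ω} [SFinite μ] {σ : ℝ} (hσ : 0 < σ) (X Y : Ω → V)
    (y : V) :
    gaussianMixturePDF μ σ X y * gaussianMixturePDF μ σ Y y / isotropicGaussianPDF σ 0 y
      = ∫ z : Ω × Ω, Real.exp (inner ℝ (X z.1) (Y z.2) / σ ^ 2)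
          * isotropicGaussianPDF σ (X z.1 + Y z.2) y ∂μ.prod μ := by
  simp_rw [← isotropicGaussianPDF_mul_div hσ, integral_div]
  rw [integral_prod_mul (fun ω => isotropicGaussianPDF σ (X ω) y)
    fun ω => isotropicGaussianPDF σ (Y ω) y]
  rfl

variable [FiniteDimensional ℝ V] [MeasurableSpace V] [BorelSpace V]

/-- The law of `X + σ ε`, where `X` is a random vector under `μ` and `ε` is an independent standard
Gaussian vector. -/
def gaussianMixture (μ : Measure Ω) (σ : ℝ) (X : Ω → V) : Measure V :=
  volume.withDensity fun y => ENNReal.ofReal (gaussianMixturePDF μ σ X y)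

variable {μ : Measure Ω} [IsProbabilityMeasure μ] {σ : ℝ} {X Y : Ω → V}

theorem measurable_uncurry_isotropicGaussianPDF (σ : ℝ) (hX : Measurable X) :
    Measurable (Function.uncurry fun ω y => isotropicGaussianPDF σ (X ω) y) :=
  (continuous_isotropicGaussianPDF σ).measurable.comp (f := fun z : Ω × V => (X z.1, z.2))
    ((hX.comp measurable_fst).prodMk measurable_snd)

theorem integrable_isotropicGaussianPDF_comp (hσ : 0 < σ) (hX : Measurable X) (y : V) :
    Integrable (fun ω => isotropicGaussianPDF σ (X ω) y) μ := by
  refine .of_bound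
    (measurable_uncurry_isotropicGaussianPDF σ hX).of_uncurry_right.aestronglyMeasurable
    ((2 * Real.pi * σ ^ 2) ^ (Module.finrank ℝ V / 2 : ℝ))⁻¹ (ae_of_all _ fun ω => ?_)
  rw [Real.norm_of_nonneg (isotropicGaussianPDF_pos hσ _ _).le]
  exact isotropicGaussianPDF_le σ (X ω) y

theorem gaussianMixturePDF_pos (hσ : 0 < σ) (hX : Measurable X) (y : V) :
    0 < gaussianMixturePDF μ σ X y :=
  integral_pos_of_forall_pos (integrable_isotropicGaussianPDF_comp hσ hX y) fun ω =>
    isotropicGaussianPDF_pos hσ (X ω) y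

theorem measurable_gaussianMixturePDF (σ : ℝ) (hX : Measurable X) :
    Measurable (gaussianMixturePDF μ σ X) :=
  measurable_integral_of_uncurry (measurable_uncurry_isotropicGaussianPDF σ hX)

theorem isProbabilityMeasure_gaussianMixture (hσ : 0 < σ) (hX : Measurable X) :
    IsProbabilityMeasure (gaussianMixture μ σ X) := by
  have (ω : Ω) := isProbabilityMeasure_isotropicGaussian hσ (X ω)
  exact isProbabilityMeasure_withDensity_integral (measurable_uncurry_isotropicGaussianPDF σ hX)
    (fun ω y => (isotropicGaussianPDF_pos hσ (X ω) y).le)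
    (integrable_isotropicGaussianPDF_comp hσ hX)

theorem klDiv_gaussianMixture_le_lintegral (hσ : 0 < σ) (hX : Measurable X) (hY : Measurable Y) :
    klDiv (gaussianMixture μ σ X) (gaussianMixture μ σ Y)
      ≤ ∫⁻ ω, ENNReal.ofReal (‖X ω - Y ω‖ ^ 2 / (2 * σ ^ 2)) ∂μ := by
  have (ω : Ω) := isProbabilityMeasure_isotropicGaussian hσ (X ω)
  have (ω : Ω) := isProbabilityMeasure_isotropicGaussian hσ (Y ω)
  simp only [← klDiv_isotropicGaussian hσ]
  exact klDiv_withDensity_integral_le (measurable_uncurry_isotropicGaussianPDF σ hX)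
    (measurable_uncurry_isotropicGaussianPDF σ hY) (fun ω => isotropicGaussianPDF_pos hσ (X ω))
    (fun ω => isotropicGaussianPDF_pos hσ (Y ω)) (integrable_isotropicGaussianPDF_comp hσ hX)
    (integrable_isotropicGaussianPDF_comp hσ hY)

theorem isotropicGaussianPDF_zero_le_exp_mul_gaussianMixturePDF (hσ : 0 < σ) (hY : Measurable Y)
    {R : ℝ} (hYR : ∀ ω, ‖Y ω‖ ≤ R) (hY₀ : ∫ ω, Y ω ∂μ = 0) (y : V) :
    isotropicGaussianPDF σ 0 y
      ≤ Real.exp (R ^ 2 / (2 * σ ^ 2)) * gaussianMixturePDF μ σ Y y := by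
  have hYint : Integrable Y μ := .of_bound hY.aestronglyMeasurable R (ae_of_all _ hYR)
  have hlin : Integrable (fun ω => 1 + inner ℝ y (Y ω) / σ ^ 2) μ :=
    (integrable_const 1).add ((hYint.const_inner y).div_const _)
  have hmean : ∫ ω, (1 + inner ℝ y (Y ω) / σ ^ 2) ∂μ = 1 := by
    rw [integral_add (integrable_const 1) ((hYint.const_inner y).div_const _), integral_div,
      integral_inner hYint, hY₀]
    simp
  have hpoint (ω : Ω) : isotropicGaussianPDF σ 0 y * (1 + inner ℝ y (Y ω) / σ ^ 2)
      ≤ Real.exp (R ^ 2 / (2 * σ ^ 2)) * isotropicGaussianPDF σ (Y ω) y := by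
    have hφ := isotropicGaussianPDF_pos hσ 0 y
    have htilt : 1 + inner ℝ y (Y ω) / σ ^ 2 ≤ Real.exp (inner ℝ (Y ω) y / σ ^ 2) := by
      rw [real_inner_comm, add_comm]
      exact Real.add_one_le_exp _
    have hnorm : 1 ≤ Real.exp (R ^ 2 / (2 * σ ^ 2)) * Real.exp (-‖Y ω‖ ^ 2 / (2 * σ ^ 2)) := by
      rw [← Real.exp_add, Real.one_le_exp_iff, ← add_div]
      have := pow_le_pow_left₀ (norm_nonneg _) (hYR ω) 2
      exact div_nonneg (by linarith) (by positivity)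
    rw [isotropicGaussianPDF_eq_mul_exp_inner hσ (Y ω), ← mul_assoc]
    exact (mul_le_mul_of_nonneg_left htilt hφ.le).trans
      (le_mul_of_one_le_left (by positivity) hnorm)
  calc isotropicGaussianPDF σ 0 y
      = ∫ ω, isotropicGaussianPDF σ 0 y * (1 + inner ℝ y (Y ω) / σ ^ 2) ∂μ := by
        rw [integral_const_mul, hmean, mul_one]
    _ ≤ ∫ ω, Real.exp (R ^ 2 / (2 * σ ^ 2)) * isotropicGaussianPDF σ (Y ω) y ∂μ :=
        integral_mono (hlin.const_mul _)
          ((integrable_isotropicGaussianPDF_comp hσ hY y).const_mul _) hpoint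
    _ = Real.exp (R ^ 2 / (2 * σ ^ 2)) * gaussianMixturePDF μ σ Y y := integral_const_mul _ _

theorem measurable_inner_prod (hX : Measurable X) (hY : Measurable Y) :
    Measurable fun z : Ω × Ω => (inner ℝ (X z.1) (Y z.2) : ℝ) :=
  (hX.comp measurable_fst).inner (hY.comp measurable_snd)

/-- `E exp (⟪X, Y'⟫ / σ²)` for an independent copy `Y'` of `Y`: the inner product of the densities
of `X + σ ε` and `Y + σ ε` relative to that of `σ ε`. -/
def gaussianOverlap (μ : Measure Ω) (σ : ℝ) (X Y : Ω → V) : ℝ :=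
  ∫ z : Ω × Ω, Real.exp (inner ℝ (X z.1) (Y z.2) / σ ^ 2) ∂μ.prod μ

theorem integrable_exp_inner_prod (hX : Measurable X) (hY : Measurable Y) {R : ℝ}
    (hXR : ∀ ω, ‖X ω‖ ≤ R) (hYR : ∀ ω, ‖Y ω‖ ≤ R) :
    Integrable (fun z : Ω × Ω => Real.exp (inner ℝ (X z.1) (Y z.2) / σ ^ 2)) (μ.prod μ) := by
  refine .of_bound ((measurable_inner_prod hX hY).div_const _).exp.aestronglyMeasurable
    (Real.exp (R ^ 2 / σ ^ 2)) (ae_of_all _ fun z => ?_)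
  rw [Real.norm_of_nonneg (Real.exp_pos _).le, Real.exp_le_exp]
  exact div_le_div_of_nonneg_right (abs_le.1 (abs_inner_le_sq (hXR z.1) (hYR z.2))).2
    (sq_nonneg σ)

theorem integrable_exp_inner_mul_isotropicGaussianPDF (hσ : 0 < σ) (hX : Measurable X)
    (hY : Measurable Y) {R : ℝ} (hXR : ∀ ω, ‖X ω‖ ≤ R) (hYR : ∀ ω, ‖Y ω‖ ≤ R) :
    Integrable (fun w : (Ω × Ω) × V => Real.exp (inner ℝ (X w.1.1) (Y w.1.2) / σ ^ 2)
      * isotropicGaussianPDF σ (X w.1.1 + Y w.1.2) w.2) ((μ.prod μ).prod volume) := by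
  have hsum : Measurable fun z : Ω × Ω => X z.1 + Y z.2 :=
    (hX.comp measurable_fst).add (hY.comp measurable_snd)
  have hexp : Measurable fun w : (Ω × Ω) × V => Real.exp (inner ℝ (X w.1.1) (Y w.1.2) / σ ^ 2) :=
    ((measurable_inner_prod hX hY).div_const (σ ^ 2)).exp.comp measurable_fst
  have hpdf := measurable_uncurry_isotropicGaussianPDF σ hsum
  refine (integrable_prod_iff (hexp.mul hpdf).aestronglyMeasurable).2 ⟨ae_of_all _ fun z =>
    (integrable_isotropicGaussianPDF hσ (X z.1 + Y z.2)).const_mul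
      (Real.exp (inner ℝ (X z.1) (Y z.2) / σ ^ 2)), ?_⟩
  refine (integrable_exp_inner_prod (σ := σ) hX hY hXR hYR).congr (ae_of_all _ fun z => ?_)
  simp only [Pi.mul_apply, Function.uncurry_apply_pair, norm_mul,
    Real.norm_of_nonneg (Real.exp_pos _).le,
    Real.norm_of_nonneg (isotropicGaussianPDF_pos hσ _ _).le, integral_const_mul,
    integral_isotropicGaussianPDF hσ, mul_one]

theorem integrable_gaussianMixturePDF_mul_div (hσ : 0 < σ) (hX : Measurable X)
    (hY : Measurable Y) {R : ℝ} (hXR : ∀ ω, ‖X ω‖ ≤ R) (hYR : ∀ ω, ‖Y ω‖ ≤ R) :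
    Integrable fun y =>
      gaussianMixturePDF μ σ X y * gaussianMixturePDF μ σ Y y / isotropicGaussianPDF σ 0 y := by
  simp only [gaussianMixturePDF_mul_div hσ]
  exact (integrable_exp_inner_mul_isotropicGaussianPDF hσ hX hY hXR hYR).integral_prod_right

theorem integral_gaussianMixturePDF_mul_div (hσ : 0 < σ) (hX : Measurable X) (hY : Measurable Y)
    {R : ℝ} (hXR : ∀ ω, ‖X ω‖ ≤ R) (hYR : ∀ ω, ‖Y ω‖ ≤ R) :
    ∫ y, gaussianMixturePDF μ σ X y * gaussianMixturePDF μ σ Y y / isotropicGaussianPDF σ 0 y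
      = gaussianOverlap μ σ X Y := by
  simp only [gaussianMixturePDF_mul_div hσ]
  rw [← integral_integral_swap
    (integrable_exp_inner_mul_isotropicGaussianPDF hσ hX hY hXR hYR)]
  simp only [integral_const_mul, integral_isotropicGaussianPDF hσ, mul_one, gaussianOverlap]

theorem klDiv_gaussianMixture_le_gaussianOverlap (hσ : 0 < σ) (hX : Measurable X)
    (hY : Measurable Y) {R : ℝ} (hXR : ∀ ω, ‖X ω‖ ≤ R) (hYR : ∀ ω, ‖Y ω‖ ≤ R)
    (hY₀ : ∫ ω, Y ω ∂μ = 0) :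
    klDiv (gaussianMixture μ σ X) (gaussianMixture μ σ Y)
      ≤ ENNReal.ofReal (Real.exp (R ^ 2 / (2 * σ ^ 2)) * (gaussianOverlap μ σ X X
          - 2 * gaussianOverlap μ σ X Y + gaussianOverlap μ σ Y Y)) := by
  have hexpand : (fun y => (gaussianMixturePDF μ σ X y - gaussianMixturePDF μ σ Y y) ^ 2
        / isotropicGaussianPDF σ 0 y)
      = (fun y => gaussianMixturePDF μ σ X y * gaussianMixturePDF μ σ X y
          / isotropicGaussianPDF σ 0 y)
        - (fun y => 2 * (gaussianMixturePDF μ σ X y * gaussianMixturePDF μ σ Y y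
          / isotropicGaussianPDF σ 0 y))
        + (fun y => gaussianMixturePDF μ σ Y y * gaussianMixturePDF μ σ Y y
          / isotropicGaussianPDF σ 0 y) := by
    funext y
    simp only [Pi.add_apply, Pi.sub_apply]
    ring
  have hXX := integrable_gaussianMixturePDF_mul_div (μ := μ) hσ hX hX hXR hXR
  have hXY := (integrable_gaussianMixturePDF_mul_div (μ := μ) hσ hX hY hXR hYR).const_mul 2
  have hYY := integrable_gaussianMixturePDF_mul_div (μ := μ) hσ hY hY hYR hYR
  have := isProbabilityMeasure_gaussianMixture (μ := μ) hσ hX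
  have := isProbabilityMeasure_gaussianMixture (μ := μ) hσ hY
  unfold gaussianMixture at *
  refine (klDiv_withDensity_le_ofReal_mul_integral (measurable_gaussianMixturePDF σ hX)
    (measurable_gaussianMixturePDF σ hY) (fun y => (gaussianMixturePDF_pos hσ hX y).le)
    (gaussianMixturePDF_pos hσ hY) (isotropicGaussianPDF_pos hσ 0)
    (isotropicGaussianPDF_zero_le_exp_mul_gaussianMixturePDF hσ hY hYR hY₀)
    (hexpand ▸ (hXX.sub hXY).add hYY)).trans_eq ?_
  rw [hexpand, integral_add' (hXX.sub hXY) hYY, integral_sub' hXX hXY, integral_const_mul,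
    integral_gaussianMixturePDF_mul_div hσ hX hX hXR hXR,
    integral_gaussianMixturePDF_mul_div hσ hX hY hXR hYR,
    integral_gaussianMixturePDF_mul_div hσ hY hY hYR hYR]

/-- `E ⟪X, Y'⟫ ^ m` for an independent copy `Y'` of `Y`: the inner product of the `m`-th moment
tensors `E X^{⊗m}` and `E Y^{⊗m}`. -/
def momentInner (μ : Measure Ω) (X Y : Ω → V) (m : ℕ) : ℝ :=
  ∫ z : Ω × Ω, (inner ℝ (X z.1) (Y z.2) : ℝ) ^ m ∂μ.prod μ

/-- The squared distance `‖E X^{⊗m} - E Y^{⊗m}‖²` between the `m`-th moment tensors, written out in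
inner products. -/
def momentGap (μ : Measure Ω) (X Y : Ω → V) (m : ℕ) : ℝ :=
  momentInner μ X X m - 2 * momentInner μ X Y m + momentInner μ Y Y m

theorem hasSum_momentInner (σ : ℝ) (hX : Measurable X) (hY : Measurable Y) {R : ℝ}
    (hXR : ∀ ω, ‖X ω‖ ≤ R) (hYR : ∀ ω, ‖Y ω‖ ≤ R) :
    HasSum (fun m => momentInner μ X Y m / (m.factorial * σ ^ (2 * m)))
      (gaussianOverlap μ σ X Y) := by
  have hterm (m : ℕ) (z : Ω × Ω) : (inner ℝ (X z.1) (Y z.2) / σ ^ 2) ^ m / m.factorial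
      = (inner ℝ (X z.1) (Y z.2) : ℝ) ^ m / (m.factorial * σ ^ (2 * m)) := by
    rw [div_pow, ← pow_mul, div_div, mul_comm (σ ^ _)]
  have hbound (m : ℕ) (z : Ω × Ω) : ‖(inner ℝ (X z.1) (Y z.2) / σ ^ 2) ^ m / m.factorial‖
      ≤ (R ^ 2 / σ ^ 2) ^ m / m.factorial := by
    rw [norm_div, norm_pow, norm_div, Real.norm_eq_abs, norm_pow, Real.norm_eq_abs σ, sq_abs,
      Real.norm_natCast]
    have := abs_inner_le_sq (hXR z.1) (hYR z.2)
    gcongr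
  have hint (m : ℕ) : Integrable
      (fun z : Ω × Ω => (inner ℝ (X z.1) (Y z.2) / σ ^ 2) ^ m / m.factorial) (μ.prod μ) :=
    .of_bound ((((measurable_inner_prod hX hY).div_const _).pow_const m).div_const
      _).aestronglyMeasurable _ (ae_of_all _ (hbound m))
  have hsum : Summable fun m : ℕ =>
      ∫ z : Ω × Ω, ‖(inner ℝ (X z.1) (Y z.2) / σ ^ 2) ^ m / m.factorial‖ ∂μ.prod μ := by
    refine .of_nonneg_of_le (fun m => integral_nonneg fun z => norm_nonneg _) (fun m => ?_)
      (Real.summable_pow_div_factorial (R ^ 2 / σ ^ 2))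
    simpa using integral_mono (hint m).norm (integrable_const _) (hbound m)
  have hseries := hasSum_integral_of_summable_integral_norm hint hsum
  simp only [← congrFun NormedSpace.exp_eq_tsum_div, ← Real.exp_eq_exp_ℝ] at hseries
  simp only [hterm, integral_div] at hseries
  exact hseries

theorem hasSum_momentGap (σ : ℝ) (hX : Measurable X) (hY : Measurable Y) {R : ℝ}
    (hXR : ∀ ω, ‖X ω‖ ≤ R) (hYR : ∀ ω, ‖Y ω‖ ≤ R) :
    HasSum (fun m => momentGap μ X Y m / (m.factorial * σ ^ (2 * m)))
      (gaussianOverlap μ σ X X - 2 * gaussianOverlap μ σ X Y + gaussianOverlap μ σ Y Y) := by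
  have hgap := ((hasSum_momentInner (μ := μ) σ hX hX hXR hXR).sub
    ((hasSum_momentInner (μ := μ) σ hX hY hXR hYR).mul_left 2)).add
      (hasSum_momentInner (μ := μ) σ hY hY hYR hYR)
  refine hgap.congr_fun fun m => ?_
  rw [momentGap]
  ring

theorem klDiv_gaussianMixture_le_tsum_momentGap (hσ : 0 < σ) (hX : Measurable X)
    (hY : Measurable Y) {R : ℝ} (hXR : ∀ ω, ‖X ω‖ ≤ R) (hYR : ∀ ω, ‖Y ω‖ ≤ R)
    (hY₀ : ∫ ω, Y ω ∂μ = 0) :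
    klDiv (gaussianMixture μ σ X) (gaussianMixture μ σ Y)
      ≤ ENNReal.ofReal (Real.exp (R ^ 2 / (2 * σ ^ 2))
          * ∑' m, momentGap μ X Y m / (m.factorial * σ ^ (2 * m))) := by
  rw [(hasSum_momentGap σ hX hY hXR hYR).tsum_eq]
  exact klDiv_gaussianMixture_le_gaussianOverlap hσ hX hY hXR hYR hY₀

end GaussianMixture

section MomentCoordinates

variable {V : Type*} [NormedAddCommGroup V] [InnerProductSpace ℝ V] {Ω : Type*}
  [MeasurableSpace Ω] {ι : Type*} [Fintype ι] {μ : Measure Ω} [SFinite μ] {X Y : Ω → V}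
  {ξ : V → ι → ℂ} {m : ℕ}

theorem momentInner_eq_sum
    (hξ : ∀ x y, ((inner ℝ x y : ℝ) : ℂ) = ∑ p, (starRingEnd ℂ) (ξ x p) * ξ y p)
    (hX : ∀ κ : Fin m → ι, Integrable (fun ω => ∏ j, ξ (X ω) (κ j)) μ)
    (hY : ∀ κ : Fin m → ι, Integrable (fun ω => ∏ j, ξ (Y ω) (κ j)) μ) :
    (momentInner μ X Y m : ℂ) = ∑ κ : Fin m → ι,
      (starRingEnd ℂ) (∫ ω, ∏ j, ξ (X ω) (κ j) ∂μ) * ∫ ω, ∏ j, ξ (Y ω) (κ j) ∂μ := by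
  have hexpand (z : Ω × Ω) : (((inner ℝ (X z.1) (Y z.2) : ℝ) ^ m : ℝ) : ℂ)
      = ∑ κ : Fin m → ι,
        (starRingEnd ℂ) (∏ j, ξ (X z.1) (κ j)) * ∏ j, ξ (Y z.2) (κ j) := by
    rw [Complex.ofReal_pow, hξ, Fintype.sum_pow]
    simp only [Finset.prod_mul_distrib, map_prod]
  have hconj (κ : Fin m → ι) :
      Integrable (fun ω => (starRingEnd ℂ) (∏ j, ξ (X ω) (κ j))) μ :=
    Complex.conjLIE.toContinuousLinearEquiv.toContinuousLinearMap.integrable_comp (hX κ)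
  rw [momentInner, ← integral_complex_ofReal]
  simp only [hexpand]
  rw [integral_finsetSum _ fun κ _ => (hconj κ).mul_prod (hY κ)]
  refine Finset.sum_congr rfl fun κ _ => ?_
  rw [integral_prod_mul (fun ω => (starRingEnd ℂ) (∏ j, ξ (X ω) (κ j)))
    fun ω => ∏ j, ξ (Y ω) (κ j), integral_conj]

theorem momentGap_eq_sum_norm_sub_sq
    (hξ : ∀ x y, ((inner ℝ x y : ℝ) : ℂ) = ∑ p, (starRingEnd ℂ) (ξ x p) * ξ y p)
    (hX : ∀ κ : Fin m → ι, Integrable (fun ω => ∏ j, ξ (X ω) (κ j)) μ)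
    (hY : ∀ κ : Fin m → ι, Integrable (fun ω => ∏ j, ξ (Y ω) (κ j)) μ) :
    momentGap μ X Y m = ∑ κ : Fin m → ι,
      ‖(∫ ω, ∏ j, ξ (X ω) (κ j) ∂μ) - ∫ ω, ∏ j, ξ (Y ω) (κ j) ∂μ‖ ^ 2 := by
  have hsq (a b : ℂ) : ((starRingEnd ℂ) a * a - 2 * ((starRingEnd ℂ) a * b)
      + (starRingEnd ℂ) b * b).re = ‖a - b‖ ^ 2 := by
    rw [← Complex.normSq_eq_norm_sq, Complex.normSq_apply]
    simp only [Complex.add_re, Complex.sub_re, Complex.sub_im, Complex.mul_re, Complex.mul_im,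
      Complex.conj_re, Complex.conj_im, Complex.re_ofNat, Complex.im_ofNat]
    ring
  rw [← Complex.ofReal_re (momentGap μ X Y m), momentGap]
  push_cast
  rw [momentInner_eq_sum hξ hX hX, momentInner_eq_sum hξ hX hY, momentInner_eq_sum hξ hY hY,
    Finset.mul_sum, ← Finset.sum_sub_distrib, ← Finset.sum_add_distrib, Complex.re_sum]
  simp only [hsq]

end MomentCoordinates

section ConstrainedSums

theorem sum_fin_succ_arrow {ι M : Type*} [Fintype ι] [AddCommMonoid M] (m : ℕ)
    (g : (Fin (m + 1) → ι) → M) :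
    ∑ κ, g κ = ∑ p, ∑ κ : Fin m → ι, g (Fin.cons p κ) := by
  rw [← Fintype.sum_prod_type' (f := fun p (κ : Fin m → ι) => g (Fin.cons p κ))]
  exact (Fintype.sum_equiv (Fin.consEquiv fun _ => ι) _ _ fun _ => rfl).symm

theorem norm_add_sq_le_weighted {E : Type*} [SeminormedAddCommGroup E] (x y : E) {t : ℝ}
    (ht : 0 < t) : ‖x + y‖ ^ 2 ≤ (1 + t⁻¹) * ‖x‖ ^ 2 + (1 + t) * ‖y‖ ^ 2 := by
  have htriangle : ‖x + y‖ ^ 2 ≤ (‖x‖ + ‖y‖) ^ 2 :=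
    pow_le_pow_left₀ (norm_nonneg _) (norm_add_le x y) 2
  have hdiff : (1 + t⁻¹) * ‖x‖ ^ 2 + (1 + t) * ‖y‖ ^ 2 - (‖x‖ + ‖y‖) ^ 2
      = t⁻¹ * (‖x‖ - t * ‖y‖) ^ 2 := by
    field_simp
    ring
  have hnonneg : 0 ≤ t⁻¹ * (‖x‖ - t * ‖y‖) ^ 2 := by positivity
  linarith

theorem sum_ite_eq_le_of_injective {ι G : Type*} [Fintype ι] [DecidableEq G] {f : ι → G}
    (hf : Function.Injective f) {w : ι → ℝ} {ρ : ℝ} (hρ : 0 ≤ ρ)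
    (hw : ∀ p, w p ≤ ρ) (n : G) : ∑ p, (if f p = n then w p else 0) ≤ ρ := by
  classical
  by_cases h : ∃ p, f p = n
  · obtain ⟨p, rfl⟩ := h
    simpa only [hf.eq_iff, Finset.sum_ite_eq', Finset.mem_univ, if_true] using hw p
  · push Not at h
    simpa [h] using hρ

theorem sum_mul_le_mul_of_le {ι : Type*} [Fintype ι] {w a : ι → ℝ} {b : ℝ} (hw : ∀ p, 0 ≤ w p)
    (ha : ∀ p, a p ≤ b) :
    ∑ p, w p * a p ≤ (∑ p, w p) * b := by
  rw [Finset.sum_mul]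
  exact Finset.sum_le_sum fun p _ => mul_le_mul_of_nonneg_left (ha p) (hw p)

variable {ι G 𝕜 : Type*} [Fintype ι] [AddCommGroup G] [DecidableEq G] [NormedField 𝕜]

/-- The sum of `∏ⱼ ‖c (κ j)‖²` over the `m`-tuples of indices `κ` of total frequency `n`, where
`f p` is the frequency of the index `p`. -/
def freqMass (f : ι → G) (c : ι → 𝕜) (m : ℕ) (n : G) : ℝ :=
  ∑ κ : Fin m → ι, if ∑ j, f (κ j) = n then ‖∏ j, c (κ j)‖ ^ 2 else 0

/-- The sum of `‖∏ⱼ c (κ j) - ∏ⱼ c' (κ j)‖²` over the `m`-tuples of indices `κ` of total frequency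
`n`, where `f p` is the frequency of the index `p`. -/
def freqDist (f : ι → G) (c c' : ι → 𝕜) (m : ℕ) (n : G) : ℝ :=
  ∑ κ : Fin m → ι, if ∑ j, f (κ j) = n then ‖∏ j, c (κ j) - ∏ j, c' (κ j)‖ ^ 2 else 0

theorem freqMass_zero (f : ι → G) (c : ι → 𝕜) (n : G) :
    freqMass f c 0 n = if n = 0 then 1 else 0 := by
  simp [freqMass, eq_comm]

theorem freqMass_succ (f : ι → G) (c : ι → 𝕜) (m : ℕ) (n : G) :
    freqMass f c (m + 1) n = ∑ p, ‖c p‖ ^ 2 * freqMass f c m (n - f p) := by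
  rw [freqMass, sum_fin_succ_arrow]
  refine Finset.sum_congr rfl fun p _ => ?_
  rw [freqMass, Finset.mul_sum]
  refine Finset.sum_congr rfl fun κ _ => ?_
  simp only [Fin.sum_univ_succ, Fin.prod_univ_succ, Fin.cons_zero, Fin.cons_succ, norm_mul,
    mul_pow, mul_ite, mul_zero, eq_sub_iff_add_eq']

theorem freqDist_nonneg (f : ι → G) (c c' : ι → 𝕜) (m : ℕ) (n : G) : 0 ≤ freqDist f c c' m n :=
  Finset.sum_nonneg fun _ _ => by split_ifs <;> positivity

theorem freqDist_zero (f : ι → G) (c c' : ι → 𝕜) (n : G) : freqDist f c c' 0 n = 0 := by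
  simp [freqDist]

theorem freqDist_one (f : ι → G) (c c' : ι → 𝕜) (n : G) :
    freqDist f c c' 1 n = ∑ p, if f p = n then ‖c p - c' p‖ ^ 2 else 0 := by
  rw [freqDist, sum_fin_succ_arrow]
  simp

theorem freqDist_two (f : ι → G) (c c' : ι → 𝕜) (n : G) :
    freqDist f c c' 2 n
      = ∑ p, ∑ q, if f p + f q = n then ‖c p * c q - c' p * c' q‖ ^ 2 else 0 := by
  simp [freqDist, sum_fin_succ_arrow]

theorem freqDist_succ_le (f : ι → G) (c c' : ι → 𝕜) (m : ℕ) (n : G) {t : ℝ} (ht : 0 < t) :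
    freqDist f c c' (m + 1) n
      ≤ (1 + t⁻¹) * ∑ p, ‖c p‖ ^ 2 * freqDist f c c' m (n - f p)
        + (1 + t) * ∑ p, ‖c p - c' p‖ ^ 2 * freqMass f c' m (n - f p) := by
  have hsplit (p : ι) (κ : Fin m → ι) : ‖c p * ∏ j, c (κ j) - c' p * ∏ j, c' (κ j)‖ ^ 2
      ≤ (1 + t⁻¹) * (‖c p‖ ^ 2 * ‖∏ j, c (κ j) - ∏ j, c' (κ j)‖ ^ 2)
        + (1 + t) * (‖c p - c' p‖ ^ 2 * ‖∏ j, c' (κ j)‖ ^ 2) := by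
    have htelescope : c p * ∏ j, c (κ j) - c' p * ∏ j, c' (κ j)
        = c p * (∏ j, c (κ j) - ∏ j, c' (κ j)) + (c p - c' p) * ∏ j, c' (κ j) := by ring
    rw [htelescope, ← mul_pow, ← mul_pow, ← norm_mul, ← norm_mul]
    exact norm_add_sq_le_weighted _ _ ht
  rw [freqDist, sum_fin_succ_arrow, Finset.mul_sum, Finset.mul_sum, ← Finset.sum_add_distrib]
  refine Finset.sum_le_sum fun p _ => ?_
  rw [freqDist, freqMass, Finset.mul_sum, Finset.mul_sum, Finset.mul_sum, Finset.mul_sum,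
    ← Finset.sum_add_distrib]
  refine Finset.sum_le_sum fun κ _ => ?_
  simp only [Fin.sum_univ_succ, Fin.prod_univ_succ, Fin.cons_zero, Fin.cons_succ,
    eq_sub_iff_add_eq']
  split_ifs
  · exact hsplit p κ
  · simp

variable {f : ι → G} {c c' : ι → 𝕜} {ρ T : ℝ}

theorem freqMass_succ_le (hf : Function.Injective f) (hρ : 0 ≤ ρ) (hc : ∀ p, ‖c p‖ ^ 2 ≤ ρ)
    (hcT : ∑ p, ‖c p‖ ^ 2 ≤ T) (m : ℕ) (n : G) : freqMass f c (m + 1) n ≤ ρ * T ^ m := by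
  have hT : 0 ≤ T := (Finset.sum_nonneg fun p _ => sq_nonneg ‖c p‖).trans hcT
  induction m generalizing n with
  | zero =>
    rw [freqMass_succ]
    simpa [freqMass_zero, sub_eq_zero, eq_comm] using sum_ite_eq_le_of_injective hf hρ hc n
  | succ m ih =>
    rw [freqMass_succ]
    calc ∑ p, ‖c p‖ ^ 2 * freqMass f c (m + 1) (n - f p)
        ≤ (∑ p, ‖c p‖ ^ 2) * (ρ * T ^ m) :=
          sum_mul_le_mul_of_le (fun p => sq_nonneg _) fun p => ih _
      _ ≤ T * (ρ * T ^ m) := mul_le_mul_of_nonneg_right hcT (by positivity)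
      _ = ρ * T ^ (m + 1) := by ring

theorem sum_norm_sq_mul_freqDist_one_le (hf : Function.Injective f) (hρ : 0 ≤ ρ)
    (hc : ∀ p, ‖c p‖ ^ 2 ≤ ρ) (n : G) :
    ∑ p, ‖c p‖ ^ 2 * freqDist f c c' 1 (n - f p) ≤ (∑ p, ‖c p - c' p‖ ^ 2) * ρ := by
  calc ∑ p, ‖c p‖ ^ 2 * freqDist f c c' 1 (n - f p)
      = ∑ q, ‖c q - c' q‖ ^ 2 * ∑ p, if f p = n - f q then ‖c p‖ ^ 2 else 0 := by
        simp only [freqDist_one, Finset.mul_sum]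
        rw [Finset.sum_comm]
        refine Finset.sum_congr rfl fun q _ => Finset.sum_congr rfl fun p _ => ?_
        simp only [eq_sub_iff_add_eq, add_comm (f q), mul_ite, mul_zero, mul_comm]
    _ ≤ (∑ q, ‖c q - c' q‖ ^ 2) * ρ :=
        sum_mul_le_mul_of_le (fun q => sq_nonneg _) fun q => sum_ite_eq_le_of_injective hf hρ hc _

theorem freqDist_add_two_le (hf : Function.Injective f) (hρ : 0 ≤ ρ)
    (hc : ∀ p, ‖c p‖ ^ 2 ≤ ρ) (hc' : ∀ p, ‖c' p‖ ^ 2 ≤ ρ) (hcT : ∑ p, ‖c p‖ ^ 2 ≤ T)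
    (hcT' : ∑ p, ‖c' p‖ ^ 2 ≤ T) (m : ℕ) (n : G) :
    freqDist f c c' (m + 2) n ≤ ((m : ℝ) + 2) ^ 2 * ρ * T ^ m * ∑ p, ‖c p - c' p‖ ^ 2 := by
  have hT : 0 ≤ T := (Finset.sum_nonneg fun p _ => sq_nonneg ‖c p‖).trans hcT
  have hmass (m : ℕ) (n : G) : ∑ p, ‖c p - c' p‖ ^ 2 * freqMass f c' (m + 1) (n - f p)
      ≤ (∑ p, ‖c p - c' p‖ ^ 2) * (ρ * T ^ m) :=
    sum_mul_le_mul_of_le (fun p => sq_nonneg _) fun p => freqMass_succ_le hf hρ hc' hcT' m _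
  induction m generalizing n with
  | zero =>
    have hsucc := freqDist_succ_le f c c' 1 n one_pos
    have hdist := sum_norm_sq_mul_freqDist_one_le (c' := c') hf hρ hc n
    have hmass₀ := hmass 0 n
    norm_num at hsucc hmass₀ ⊢
    linarith
  | succ m ih =>
    set D := ∑ p, ‖c p - c' p‖ ^ 2
    have hdist : ∑ p, ‖c p‖ ^ 2 * freqDist f c c' (m + 2) (n - f p)
        ≤ T * (((m : ℝ) + 2) ^ 2 * ρ * T ^ m * D) :=
      (sum_mul_le_mul_of_le (fun p => sq_nonneg _) fun p => ih _).trans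
        (mul_le_mul_of_nonneg_right hcT (by positivity))
    -- With `s = m + 2`, the choice `t = s` gives `(1 + s⁻¹) * s² + (1 + s) = (s + 1)²`.
    calc freqDist f c c' (m + 1 + 2) n
        ≤ (1 + ((m : ℝ) + 2)⁻¹) * (T * (((m : ℝ) + 2) ^ 2 * ρ * T ^ m * D))
          + (1 + ((m : ℝ) + 2)) * (D * (ρ * T ^ (m + 1))) :=
          (freqDist_succ_le f c c' (m + 2) n (by positivity)).trans
            (add_le_add (mul_le_mul_of_nonneg_left hdist (by positivity))
              (mul_le_mul_of_nonneg_left (hmass (m + 1) n) (by positivity)))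
      _ = (((m + 1 : ℕ) : ℝ) + 2) ^ 2 * ρ * T ^ (m + 1) * D := by
          push_cast
          field_simp
          ring

theorem freqDist_add_three_div_le (hf : Function.Injective f) (hρ : 0 ≤ ρ)
    (hc : ∀ p, ‖c p‖ ^ 2 ≤ ρ) (hc' : ∀ p, ‖c' p‖ ^ 2 ≤ ρ) (hcT : ∑ p, ‖c p‖ ^ 2 ≤ T)
    (hcT' : ∑ p, ‖c' p‖ ^ 2 ≤ T) {σ : ℝ} (hσ : 0 < σ) (j : ℕ) (n : G) :
    freqDist f c c' (j + 3) n / ((j + 3).factorial * σ ^ (2 * (j + 3)))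
      ≤ 3 * ρ * T / (2 * σ ^ 6) * (∑ p, ‖c p - c' p‖ ^ 2)
        * ((T / σ ^ 2) ^ j / j.factorial) := by
  have hT : 0 ≤ T := (Finset.sum_nonneg fun p _ => sq_nonneg ‖c p‖).trans hcT
  have hdist := freqDist_add_two_le hf hρ hc hc' hcT hcT' (j + 1) n
  set D := ∑ p, ‖c p - c' p‖ ^ 2
  have hratio : ((j : ℝ) + 3) / ((j + 1) * (j + 2)) ≤ 3 / 2 := by
    rw [div_le_div_iff₀ (by positivity) two_pos]
    nlinarith [Nat.cast_nonneg (α := ℝ) j]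
  have hfac : ((j + 3).factorial : ℝ) = (j + 3) * (j + 2) * (j + 1) * j.factorial := by
    simp only [Nat.factorial_succ]
    push_cast
    ring
  calc freqDist f c c' (j + 3) n / ((j + 3).factorial * σ ^ (2 * (j + 3)))
      ≤ (((j + 1 : ℕ) : ℝ) + 2) ^ 2 * ρ * T ^ (j + 1) * D
          / ((j + 3).factorial * σ ^ (2 * (j + 3))) :=
        div_le_div_of_nonneg_right hdist (by positivity)
    _ = ((j : ℝ) + 3) / ((j + 1) * (j + 2))
          * (ρ * T / σ ^ 6 * D * ((T / σ ^ 2) ^ j / j.factorial)) := by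
        rw [hfac, div_pow, ← pow_mul]
        push_cast
        field_simp
        ring
    _ ≤ 3 / 2 * (ρ * T / σ ^ 6 * D * ((T / σ ^ 2) ^ j / j.factorial)) :=
        mul_le_mul_of_nonneg_right hratio (by positivity)
    _ = 3 * ρ * T / (2 * σ ^ 6) * D * ((T / σ ^ 2) ^ j / j.factorial) := by ring

theorem tsum_freqDist_div_le (hf : Function.Injective f) (hρ : 0 ≤ ρ)
    (hc : ∀ p, ‖c p‖ ^ 2 ≤ ρ) (hc' : ∀ p, ‖c' p‖ ^ 2 ≤ ρ) (hcT : ∑ p, ‖c p‖ ^ 2 ≤ T)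
    (hcT' : ∑ p, ‖c' p‖ ^ 2 ≤ T) {σ : ℝ} (hσ : 0 < σ) (n : G) :
    ∑' m, freqDist f c c' m n / (m.factorial * σ ^ (2 * m))
      ≤ ∑ m ∈ Finset.range 3, freqDist f c c' m n / (m.factorial * σ ^ (2 * m))
        + 3 * ρ * T / (2 * σ ^ 6) * (∑ p, ‖c p - c' p‖ ^ 2) * Real.exp (T / σ ^ 2) := by
  have hmajorant : HasSum (fun j : ℕ => 3 * ρ * T / (2 * σ ^ 6) * (∑ p, ‖c p - c' p‖ ^ 2)
        * ((T / σ ^ 2) ^ j / j.factorial))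
      (3 * ρ * T / (2 * σ ^ 6) * (∑ p, ‖c p - c' p‖ ^ 2) * Real.exp (T / σ ^ 2)) := by
    rw [Real.exp_eq_exp_ℝ]
    exact (NormedSpace.expSeries_div_hasSum_exp (T / σ ^ 2)).mul_left _
  have hle := freqDist_add_three_div_le hf hρ hc hc' hcT hcT' hσ (n := n)
  have htail : Summable fun j : ℕ =>
      freqDist f c c' (j + 3) n / ((j + 3).factorial * σ ^ (2 * (j + 3))) :=
    .of_nonneg_of_le (fun j => div_nonneg (freqDist_nonneg f c c' _ n) (by positivity)) hle
      hmajorant.summable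
  have hsum : Summable fun m : ℕ => freqDist f c c' m n / (m.factorial * σ ^ (2 * m)) :=
    (summable_nat_add_iff 3).1 htail
  rw [← hsum.sum_add_tsum_nat_add 3, ← hmajorant.tsum_eq]
  exact add_le_add_right (htail.tsum_le_tsum hle hmajorant.summable) _

end ConstrainedSums

section UniformAngle

/-- The uniform distribution of an angle, realized on `(-π, π]`. -/
def uniformAngle : Measure ℝ :=
  ProbabilityTheory.cond volume (Set.Ioc (-Real.pi) Real.pi)

instance : IsProbabilityMeasure uniformAngle :=
  ProbabilityTheory.cond_isProbabilityMeasure_of_finite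
    (by simp [Real.pi_pos]) (by simp [Real.volume_Ioc])

variable {F : Type*} [NormedAddCommGroup F] [NormedSpace ℝ F]

theorem integral_uniformAngle (f : ℝ → F) :
    ∫ α, f α ∂uniformAngle = (2 * Real.pi)⁻¹ • ∫ α in (-Real.pi)..Real.pi, f α := by
  have hlength : Real.pi - -Real.pi = 2 * Real.pi := by ring
  rw [uniformAngle, ProbabilityTheory.cond, integral_smul_measure,
    intervalIntegral.integral_of_le (by linarith [Real.pi_pos]), Real.volume_Ioc, hlength,
    ENNReal.toReal_inv, ENNReal.toReal_ofReal Real.two_pi_pos.le]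

theorem integral_uniformAngle_add {f : ℝ → F} (hf : Function.Periodic f (2 * Real.pi)) (β : ℝ) :
    ∫ α, f (α + β) ∂uniformAngle = ∫ α, f α ∂uniformAngle := by
  have hend : Real.pi + β = -Real.pi + β + 2 * Real.pi := by ring
  have hend₀ : -Real.pi + 2 * Real.pi = Real.pi := by ring
  rw [integral_uniformAngle, integral_uniformAngle, intervalIntegral.integral_comp_add_right,
    hend, hf.intervalIntegral_add_eq (-Real.pi + β) (-Real.pi), hend₀]

theorem integral_uniformAngle_exp (n : ℤ) :
    ∫ α : ℝ, Complex.exp (n * Complex.I * α) ∂uniformAngle = if n = 0 then 1 else 0 := by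
  split_ifs with hn
  · simp [hn]
  · have hperiodic : Complex.exp (n * Complex.I * (Real.pi : ℝ))
        = Complex.exp (n * Complex.I * ((-Real.pi : ℝ) : ℂ)) := by
      rw [Complex.exp_eq_exp_iff_exists_int]
      exact ⟨n, by push_cast; ring⟩
    rw [integral_uniformAngle, integral_exp_mul_complex (by simp [hn]), hperiodic, sub_self,
      zero_div, smul_zero]

end UniformAngle

section Rotation

variable {K : ℕ}

theorem mraRot_apply_zero (α : ℝ) (θ : EuclideanSpace ℝ (Fin K × Fin 2)) (k : Fin K) :
    mraRot α θ (k, 0) = Real.cos (((k : ℕ) + 1 : ℝ) * α) * θ (k, 0)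
      - Real.sin (((k : ℕ) + 1 : ℝ) * α) * θ (k, 1) := by
  simp [mraRot]

theorem mraRot_apply_one (α : ℝ) (θ : EuclideanSpace ℝ (Fin K × Fin 2)) (k : Fin K) :
    mraRot α θ (k, 1) = Real.sin (((k : ℕ) + 1 : ℝ) * α) * θ (k, 0)
      + Real.cos (((k : ℕ) + 1 : ℝ) * α) * θ (k, 1) := by
  simp [mraRot]

theorem euclidean_pair_ext {ι : Type*} {x y : EuclideanSpace ℝ (ι × Fin 2)}
    (h₀ : ∀ k, x (k, 0) = y (k, 0)) (h₁ : ∀ k, x (k, 1) = y (k, 1)) : x = y := by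
  ext ⟨k, j⟩
  fin_cases j
  · exact h₀ k
  · exact h₁ k

/-- The squared magnitude `r_k² = θ_{k,1}² + θ_{k,2}²` of the Fourier coefficient of `θ` at the
frequency indexed by `k`. -/
def bandEnergy (θ : EuclideanSpace ℝ (Fin K × Fin 2)) (k : Fin K) : ℝ :=
  θ (k, 0) ^ 2 + θ (k, 1) ^ 2

theorem norm_sq_eq_sum_bandEnergy (θ : EuclideanSpace ℝ (Fin K × Fin 2)) :
    ‖θ‖ ^ 2 = ∑ k, bandEnergy θ k := by
  rw [EuclideanSpace.real_norm_sq_eq, Fintype.sum_prod_type]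
  simp [bandEnergy]

theorem bandEnergy_mraRot (α : ℝ) (θ : EuclideanSpace ℝ (Fin K × Fin 2)) (k : Fin K) :
    bandEnergy (mraRot α θ) k = bandEnergy θ k := by
  simp only [bandEnergy, mraRot_apply_zero, mraRot_apply_one]
  linear_combination (θ (k, 0) ^ 2 + θ (k, 1) ^ 2)
    * Real.sin_sq_add_cos_sq (((k : ℕ) + 1 : ℝ) * α)

theorem norm_mraRot (α : ℝ) (θ : EuclideanSpace ℝ (Fin K × Fin 2)) : ‖mraRot α θ‖ = ‖θ‖ := by
  rw [← sq_eq_sq₀ (norm_nonneg _) (norm_nonneg _)]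
  simp only [norm_sq_eq_sum_bandEnergy, bandEnergy_mraRot]

theorem mraRot_sub (α : ℝ) (x y : EuclideanSpace ℝ (Fin K × Fin 2)) :
    mraRot α (x - y) = mraRot α x - mraRot α y := by
  apply euclidean_pair_ext <;> intro k <;>
    simp only [mraRot_apply_zero, mraRot_apply_one, PiLp.sub_apply] <;> ring

theorem mraRot_mraRot (α β : ℝ) (x : EuclideanSpace ℝ (Fin K × Fin 2)) :
    mraRot α (mraRot β x) = mraRot (α + β) x := by
  apply euclidean_pair_ext <;> intro k <;>
    simp only [mraRot_apply_zero, mraRot_apply_one, mul_add, Real.cos_add, Real.sin_add] <;> ring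

theorem mraRot_periodic (x : EuclideanSpace ℝ (Fin K × Fin 2)) :
    Function.Periodic (fun α => mraRot α x) (2 * Real.pi) := by
  intro α
  have hmul (k : Fin K) : ((k : ℕ) + 1 : ℝ) * (α + 2 * Real.pi)
      = ((k : ℕ) + 1 : ℝ) * α + ((k + 1 : ℕ) : ℝ) * (2 * Real.pi) := by
    push_cast
    ring
  apply euclidean_pair_ext <;> intro k <;>
    simp only [mraRot_apply_zero, mraRot_apply_one, hmul, Real.cos_add_nat_mul_two_pi,
      Real.sin_add_nat_mul_two_pi]

theorem continuous_mraRot (x : EuclideanSpace ℝ (Fin K × Fin 2)) :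
    Continuous fun α => mraRot α x := by
  refine (PiLp.continuous_toLp 2 _).comp (continuous_pi ?_)
  rintro ⟨k, j⟩
  fin_cases j <;> simp only [Fin.zero_eta, Fin.mk_one, Matrix.cons_val_zero, Matrix.cons_val_one,
    Matrix.cons_val_fin_one] <;> fun_prop

theorem mraDensity_eq_gaussianMixturePDF (σ : ℝ) (θ : EuclideanSpace ℝ (Fin K × Fin 2)) :
    mraDensity σ θ = gaussianMixturePDF uniformAngle σ fun α => mraRot α θ := by
  funext y
  have hdim : (Module.finrank ℝ (EuclideanSpace ℝ (Fin K × Fin 2)) / 2 : ℝ) = K := by simp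
  simp only [mraDensity, gaussianMixturePDF, integral_uniformAngle, isotropicGaussianPDF, hdim,
    Real.rpow_natCast, smul_eq_mul]

theorem mraLaw_eq_gaussianMixture (σ : ℝ) (θ : EuclideanSpace ℝ (Fin K × Fin 2)) :
    mraLaw σ θ = gaussianMixture uniformAngle σ fun α => mraRot α θ := by
  rw [mraLaw, mraDensity_eq_gaussianMixturePDF, gaussianMixture]

theorem mraLaw_mraRot (σ β : ℝ) (θ : EuclideanSpace ℝ (Fin K × Fin 2)) :
    mraLaw σ (mraRot β θ) = mraLaw σ θ := by
  have hshift (y : EuclideanSpace ℝ (Fin K × Fin 2)) :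
      gaussianMixturePDF uniformAngle σ (fun α => mraRot (α + β) θ) y
        = gaussianMixturePDF uniformAngle σ (fun α => mraRot α θ) y :=
    integral_uniformAngle_add ((mraRot_periodic θ).comp fun x => isotropicGaussianPDF σ x y) β
  simp only [mraLaw_eq_gaussianMixture, mraRot_mraRot, gaussianMixture, hshift]

theorem klDiv_mraLaw_le_norm_sub_sq {σ : ℝ} (hσ : 0 < σ)
    (θ θ' : EuclideanSpace ℝ (Fin K × Fin 2)) :
    klDiv (mraLaw σ θ) (mraLaw σ θ') ≤ ENNReal.ofReal (‖θ - θ'‖ ^ 2 / (2 * σ ^ 2)) := by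
  rw [mraLaw_eq_gaussianMixture, mraLaw_eq_gaussianMixture]
  refine (klDiv_gaussianMixture_le_lintegral hσ (continuous_mraRot θ).measurable
    (continuous_mraRot θ').measurable).trans_eq ?_
  simp only [← mraRot_sub, norm_mraRot, lintegral_const, measure_univ, mul_one]

end Rotation

section FourierCoordinates

variable {K : ℕ}

/-- The frequency `k` or `-k` of a complex Fourier coordinate; the index `(i, b)` stands for `i + 1`
if `b` is true and for `-(i + 1)` otherwise. -/
def signedFreq (p : Fin K × Bool) : ℤ :=
  if p.2 then (p.1 : ℤ) + 1 else -((p.1 : ℤ) + 1)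

/-- The complex Fourier coordinates `(θ_{k,1} ± i θ_{k,2}) / √2` of `θ`. The factor `1 / √2` makes
them unitary. -/
def fourierCoord (θ : EuclideanSpace ℝ (Fin K × Fin 2)) (p : Fin K × Bool) : ℂ :=
  (√2)⁻¹ • ⟨θ (p.1, 0), if p.2 then θ (p.1, 1) else -θ (p.1, 1)⟩

theorem signedFreq_injective : Function.Injective (signedFreq (K := K)) := by
  rintro ⟨k, b⟩ ⟨l, b'⟩ h
  simp only [signedFreq] at h
  cases b <;> cases b' <;>
    simp only [Bool.false_eq_true, if_true, if_false, Prod.mk.injEq, Fin.ext_iff, and_true,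
      and_false, reduceCtorEq] at h ⊢ <;>
    omega

theorem signedFreq_ne_zero (p : Fin K × Bool) : signedFreq p ≠ 0 := by
  obtain ⟨k, b⟩ := p
  cases b <;> simp only [signedFreq, if_true, Bool.false_eq_true, if_false] <;> omega

theorem signedFreq_not (k : Fin K) (b : Bool) : signedFreq (k, !b) = -signedFreq (k, b) := by
  cases b <;> simp [signedFreq]

theorem signedFreq_add_eq_zero_iff (p q : Fin K × Bool) :
    signedFreq p + signedFreq q = 0 ↔ q = (p.1, !p.2) := by
  rw [← signedFreq_injective.eq_iff, signedFreq_not, add_comm, add_eq_zero_iff_eq_neg]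

theorem inv_sqrt_two_mul_self : (√2)⁻¹ * (√2)⁻¹ = (2⁻¹ : ℝ) := by
  rw [← mul_inv, Real.mul_self_sqrt two_pos.le]

theorem norm_fourierCoord_sq (θ : EuclideanSpace ℝ (Fin K × Fin 2)) (p : Fin K × Bool) :
    ‖fourierCoord θ p‖ ^ 2 = bandEnergy θ p.1 / 2 := by
  obtain ⟨k, b⟩ := p
  rw [fourierCoord, norm_smul, mul_pow, ← Complex.normSq_eq_norm_sq, Complex.normSq_apply,
    bandEnergy, Real.norm_eq_abs, sq_abs, sq, inv_sqrt_two_mul_self]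
  cases b <;> simp only [Bool.false_eq_true, if_true, if_false] <;> ring

theorem fourierCoord_not (θ : EuclideanSpace ℝ (Fin K × Fin 2)) (k : Fin K) (b : Bool) :
    fourierCoord θ (k, !b) = (starRingEnd ℂ) (fourierCoord θ (k, b)) := by
  cases b <;> apply Complex.ext <;> simp [fourierCoord]

theorem fourierCoord_sub (θ θ' : EuclideanSpace ℝ (Fin K × Fin 2)) (p : Fin K × Bool) :
    fourierCoord (θ - θ') p = fourierCoord θ p - fourierCoord θ' p := by
  obtain ⟨k, b⟩ := p
  simp only [fourierCoord, ← smul_sub, PiLp.sub_apply]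
  congr 1
  cases b <;> apply Complex.ext <;> simp [neg_add_eq_sub]

theorem sum_norm_fourierCoord_sq (θ : EuclideanSpace ℝ (Fin K × Fin 2)) :
    ∑ p, ‖fourierCoord θ p‖ ^ 2 = ‖θ‖ ^ 2 := by
  simp [norm_fourierCoord_sq, norm_sq_eq_sum_bandEnergy, Fintype.sum_prod_type, mul_div_cancel₀]

theorem inner_eq_sum_fourierCoord (θ θ' : EuclideanSpace ℝ (Fin K × Fin 2)) :
    ((inner ℝ θ θ' : ℝ) : ℂ) = ∑ p, (starRingEnd ℂ) (fourierCoord θ p) * fourierCoord θ' p := by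
  have hpair (z w : ℂ) : (starRingEnd ℂ) ((√2)⁻¹ • z) * ((√2)⁻¹ • w)
      = (2⁻¹ : ℝ) • ((starRingEnd ℂ) z * w) := by
    rw [← inv_sqrt_two_mul_self, mul_smul]
    simp only [Complex.real_smul, map_mul, Complex.conj_ofReal]
    ring
  rw [PiLp.inner_apply, Fintype.sum_prod_type, Fintype.sum_prod_type, Complex.ofReal_sum]
  refine Finset.sum_congr rfl fun k _ => ?_
  simp only [fourierCoord, hpair, Fintype.sum_bool, Fin.sum_univ_two]
  apply Complex.ext <;>
    simp only [RCLike.inner_apply, Real.ringHom_apply, Complex.add_re, Complex.add_im,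
      Complex.mul_re, Complex.mul_im, Complex.smul_re, Complex.smul_im, Complex.conj_re,
      Complex.conj_im, Complex.ofReal_re, Complex.ofReal_im, Bool.false_eq_true, if_true, if_false,
      smul_eq_mul] <;>
    ring

theorem fourierCoord_mraRot (α : ℝ) (θ : EuclideanSpace ℝ (Fin K × Fin 2)) (p : Fin K × Bool) :
    fourierCoord (mraRot α θ) p
      = Complex.exp (signedFreq p * Complex.I * α) * fourierCoord θ p := by
  obtain ⟨k, b⟩ := p
  have harg : (signedFreq (k, b) : ℂ) * Complex.I * α
      = ((signedFreq (k, b) * α : ℝ) : ℂ) * Complex.I := by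
    push_cast
    ring
  have hneg : (-((k : ℝ) + 1)) * α = -(((k : ℝ) + 1) * α) := by ring
  rw [harg]
  apply Complex.ext <;>
    simp only [fourierCoord, Complex.real_smul, Complex.mul_re, Complex.mul_im, Complex.ofReal_re,
      Complex.ofReal_im, Complex.exp_ofReal_mul_I_re, Complex.exp_ofReal_mul_I_im,
      mraRot_apply_zero, mraRot_apply_one] <;>
    cases b <;>
    simp only [signedFreq, Bool.false_eq_true, if_true, if_false, Int.cast_neg, Int.cast_add,
      Int.cast_natCast, Int.cast_one, hneg, Real.cos_neg, Real.sin_neg] <;> ring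

theorem prod_fourierCoord_mraRot (α : ℝ) (θ : EuclideanSpace ℝ (Fin K × Fin 2)) {m : ℕ}
    (κ : Fin m → Fin K × Bool) :
    ∏ j, fourierCoord (mraRot α θ) (κ j)
      = Complex.exp ((∑ j, signedFreq (κ j) : ℤ) * Complex.I * α)
        * ∏ j, fourierCoord θ (κ j) := by
  simp only [fourierCoord_mraRot, Finset.prod_mul_distrib, ← Complex.exp_sum, ← Finset.sum_mul,
    Int.cast_sum]

theorem integrable_prod_fourierCoord_mraRot (θ : EuclideanSpace ℝ (Fin K × Fin 2)) {m : ℕ}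
    (κ : Fin m → Fin K × Bool) :
    Integrable (fun α => ∏ j, fourierCoord (mraRot α θ) (κ j)) uniformAngle := by
  simp only [prod_fourierCoord_mraRot]
  refine .of_bound (by fun_prop) ‖∏ j, fourierCoord θ (κ j)‖ (ae_of_all _ fun α => ?_)
  have harg (n : ℤ) : (n : ℂ) * Complex.I * α = ((n * α : ℝ) : ℂ) * Complex.I := by
    push_cast
    ring
  rw [norm_mul, harg, Complex.norm_exp_ofReal_mul_I, one_mul]

theorem integral_prod_fourierCoord_mraRot (θ : EuclideanSpace ℝ (Fin K × Fin 2)) {m : ℕ}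
    (κ : Fin m → Fin K × Bool) :
    ∫ α, ∏ j, fourierCoord (mraRot α θ) (κ j) ∂uniformAngle
      = if ∑ j, signedFreq (κ j) = 0 then ∏ j, fourierCoord θ (κ j) else 0 := by
  simp only [prod_fourierCoord_mraRot, integral_mul_const, integral_uniformAngle_exp, ite_mul,
    one_mul, zero_mul]

theorem integral_mraRot (θ : EuclideanSpace ℝ (Fin K × Fin 2)) :
    ∫ α, mraRot α θ ∂uniformAngle = 0 := by
  have hint : Integrable (fun α => mraRot α θ) uniformAngle :=
    .of_bound (continuous_mraRot θ).aestronglyMeasurable ‖θ‖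
      (ae_of_all _ fun α => (norm_mraRot α θ).le)
  have hcoord (p : Fin K × Bool) :
      Integrable (fun α => fourierCoord (mraRot α θ) p) uniformAngle := by
    simpa using integrable_prod_fourierCoord_mraRot θ fun _ : Fin 1 => p
  have hcoord₀ (p : Fin K × Bool) : ∫ α, fourierCoord (mraRot α θ) p ∂uniformAngle = 0 := by
    simpa [signedFreq_ne_zero] using integral_prod_fourierCoord_mraRot θ fun _ : Fin 1 => p
  refine ext_inner_left ℝ fun v => ?_
  rw [← integral_inner hint, inner_zero_right, ← Complex.ofReal_inj, ← integral_complex_ofReal]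
  simp only [inner_eq_sum_fourierCoord]
  rw [integral_finsetSum _ fun p _ => (hcoord p).const_mul _]
  simp only [integral_const_mul, hcoord₀, mul_zero, Finset.sum_const_zero, Complex.ofReal_zero]

theorem momentGap_mraRot (θ θ' : EuclideanSpace ℝ (Fin K × Fin 2)) (m : ℕ) :
    momentGap uniformAngle (fun α => mraRot α θ) (fun α => mraRot α θ') m
      = freqDist signedFreq (fourierCoord θ) (fourierCoord θ') m 0 := by
  rw [momentGap_eq_sum_norm_sub_sq inner_eq_sum_fourierCoord
    (integrable_prod_fourierCoord_mraRot θ) (integrable_prod_fourierCoord_mraRot θ'), freqDist]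
  refine Finset.sum_congr rfl fun κ _ => ?_
  simp only [integral_prod_fourierCoord_mraRot]
  split_ifs <;> simp

theorem freqDist_signedFreq_one (c c' : Fin K × Bool → ℂ) :
    freqDist signedFreq c c' 1 0 = 0 := by
  simp [freqDist_one, signedFreq_ne_zero]

theorem freqDist_fourierCoord_two (θ θ' : EuclideanSpace ℝ (Fin K × Fin 2)) :
    freqDist signedFreq (fourierCoord θ) (fourierCoord θ') 2 0
      = (∑ k, (bandEnergy θ k - bandEnergy θ' k) ^ 2) / 2 := by
  have hpair (x : EuclideanSpace ℝ (Fin K × Fin 2)) (p : Fin K × Bool) :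
      fourierCoord x p * fourierCoord x (p.1, !p.2) = ((bandEnergy x p.1 / 2 : ℝ) : ℂ) := by
    rw [fourierCoord_not, Complex.mul_conj, Complex.normSq_eq_norm_sq, norm_fourierCoord_sq]
  simp only [freqDist_two, signedFreq_add_eq_zero_iff, Finset.sum_ite_eq', Finset.mem_univ,
    if_true, hpair, ← Complex.ofReal_sub, Complex.norm_real, Real.norm_eq_abs, sq_abs,
    Fintype.sum_prod_type, Finset.sum_div]
  exact Finset.sum_congr rfl fun k _ => by simp only [Fintype.sum_bool]; ring

theorem tsum_momentGap_mraRot_le {σ ρ T : ℝ} (hσ : 0 < σ) (hρ : 0 ≤ ρ)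
    {θ θ' : EuclideanSpace ℝ (Fin K × Fin 2)} (hθ : ∀ k, bandEnergy θ k ≤ ρ)
    (hθ' : ∀ k, bandEnergy θ' k ≤ ρ) (hT : ‖θ‖ ^ 2 ≤ T) (hT' : ‖θ'‖ ^ 2 ≤ T) :
    ∑' m, momentGap uniformAngle (fun α => mraRot α θ) (fun α => mraRot α θ') m
        / (m.factorial * σ ^ (2 * m))
      ≤ (∑ k, (bandEnergy θ k - bandEnergy θ' k) ^ 2) / (4 * σ ^ 4)
        + 3 * ρ * T * Real.exp (T / σ ^ 2) / (4 * σ ^ 6) * ‖θ - θ'‖ ^ 2 := by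
  simp only [momentGap_mraRot]
  refine (tsum_freqDist_div_le signedFreq_injective (ρ := ρ / 2) (by positivity)
    (fun p => (norm_fourierCoord_sq θ p).trans_le (by linarith [hθ p.1]))
    (fun p => (norm_fourierCoord_sq θ' p).trans_le (by linarith [hθ' p.1]))
    ((sum_norm_fourierCoord_sq θ).trans_le hT) ((sum_norm_fourierCoord_sq θ').trans_le hT')
    hσ 0).trans_eq ?_
  simp only [Finset.sum_range_succ, Finset.sum_range_zero, freqDist_zero, freqDist_signedFreq_one,
    freqDist_fourierCoord_two, ← fourierCoord_sub, sum_norm_fourierCoord_sq, Nat.factorial_two]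
  push_cast
  ring

theorem klDiv_mraLaw_le_of_bandEnergy_le {σ ρ T : ℝ} (hσ : 0 < σ) (hρ : 0 ≤ ρ)
    {θ θ' : EuclideanSpace ℝ (Fin K × Fin 2)} (hθ : ∀ k, bandEnergy θ k ≤ ρ)
    (hθ' : ∀ k, bandEnergy θ' k ≤ ρ) (hT : ‖θ‖ ^ 2 ≤ T) (hT' : ‖θ'‖ ^ 2 ≤ T) :
    klDiv (mraLaw σ θ) (mraLaw σ θ') ≤ ENNReal.ofReal (Real.exp (T / (2 * σ ^ 2))
      * ((∑ k, (bandEnergy θ k - bandEnergy θ' k) ^ 2) / (4 * σ ^ 4)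
        + 3 * ρ * T * Real.exp (T / σ ^ 2) / (4 * σ ^ 6) * ‖θ - θ'‖ ^ 2)) := by
  have hnorm {x : EuclideanSpace ℝ (Fin K × Fin 2)} (hx : ‖x‖ ^ 2 ≤ T) (α : ℝ) :
      ‖mraRot α x‖ ≤ √T := (norm_mraRot α x).trans_le (Real.le_sqrt_of_sq_le hx)
  have hkl := klDiv_gaussianMixture_le_tsum_momentGap (μ := uniformAngle) hσ
    (continuous_mraRot θ).measurable (continuous_mraRot θ').measurable (hnorm hT) (hnorm hT')
    (integral_mraRot θ')
  rw [Real.sq_sqrt ((sq_nonneg _).trans hT)] at hkl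
  rw [mraLaw_eq_gaussianMixture, mraLaw_eq_gaussianMixture]
  exact hkl.trans (ENNReal.ofReal_le_ofReal (mul_le_mul_of_nonneg_left
    (tsum_momentGap_mraRot_le hσ hρ hθ hθ' hT hT') (Real.exp_pos _).le))

end FourierCoordinates

section Polar

theorem sq_mul_cos_add_sq_mul_sin (r φ : ℝ) :
    (r * Real.cos φ) ^ 2 + (r * Real.sin φ) ^ 2 = r ^ 2 := by
  linear_combination r ^ 2 * Real.sin_sq_add_cos_sq φ

theorem polar_dist_sq_le {r r' : ℝ} (hr : 0 ≤ r) (hr' : 0 ≤ r') (φ ψ : ℝ) :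
    (r * Real.cos φ - r' * Real.cos ψ) ^ 2 + (r * Real.sin φ - r' * Real.sin ψ) ^ 2
      ≤ (r - r') ^ 2 + r * r' * (φ - ψ) ^ 2 := by
  have hcos := mul_le_mul_of_nonneg_left (Real.one_sub_sq_div_two_le_cos (x := φ - ψ))
    (mul_nonneg hr hr')
  calc (r * Real.cos φ - r' * Real.cos ψ) ^ 2 + (r * Real.sin φ - r' * Real.sin ψ) ^ 2
      = r ^ 2 + r' ^ 2 - 2 * (r * r' * Real.cos (φ - ψ)) := by
        rw [Real.cos_sub]
        linear_combination r ^ 2 * Real.sin_sq_add_cos_sq φ + r' ^ 2 * Real.sin_sq_add_cos_sq ψ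
    _ ≤ (r - r') ^ 2 + r * r' * (φ - ψ) ^ 2 := by linarith

variable {K : ℕ} {r φ r' φ' : Fin K → ℝ} {θ θ' : EuclideanSpace ℝ (Fin K × Fin 2)}

theorem le_maxMagnitude_left (r r' : Fin K → ℝ) (k : Fin K) : r k ≤ maxMagnitude r r' :=
  (le_ciSup (Set.finite_range r).bddAbove k).trans (le_max_left _ _)

theorem le_maxMagnitude_right (r r' : Fin K → ℝ) (k : Fin K) : r' k ≤ maxMagnitude r r' :=
  (le_ciSup (Set.finite_range r').bddAbove k).trans (le_max_right _ _)

theorem maxEnergy_nonneg (r r' : Fin K → ℝ) : 0 ≤ maxEnergy r r' :=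
  (Finset.sum_nonneg fun k _ => sq_nonneg (r k)).trans (le_max_left _ _)

/-- `(r k, φ k)` are polar coordinates of the Fourier coefficient of `θ` at the frequency indexed
by `k`. The magnitudes `r k` may be negative. -/
def IsPolar (θ : EuclideanSpace ℝ (Fin K × Fin 2)) (r φ : Fin K → ℝ) : Prop :=
  ∀ k, θ (k, 0) = r k * Real.cos (φ k) ∧ θ (k, 1) = r k * Real.sin (φ k)

theorem IsPolar.bandEnergy_eq (h : IsPolar θ r φ) (k : Fin K) : bandEnergy θ k = r k ^ 2 := by
  rw [bandEnergy, (h k).1, (h k).2, sq_mul_cos_add_sq_mul_sin]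

theorem IsPolar.mraRot (h : IsPolar θ r φ) (α : ℝ) :
    IsPolar (mraRot α θ) r fun k => φ k + ((k : ℕ) + 1 : ℝ) * α := by
  intro k
  rw [mraRot_apply_zero, mraRot_apply_one, (h k).1, (h k).2, Real.cos_add, Real.sin_add]
  constructor <;> ring

theorem IsPolar.norm_sub_sq_le (h : IsPolar θ r φ) (h' : IsPolar θ' r' φ') (hr : ∀ k, 0 ≤ r k)
    (hr' : ∀ k, 0 ≤ r' k) :
    ‖θ - θ'‖ ^ 2 ≤ ∑ k, ((r k - r' k) ^ 2 + r k * r' k * (φ k - φ' k) ^ 2) := by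
  rw [norm_sq_eq_sum_bandEnergy]
  refine Finset.sum_le_sum fun k _ => ?_
  rw [bandEnergy, PiLp.sub_apply, PiLp.sub_apply, (h k).1, (h k).2, (h' k).1, (h' k).2]
  exact polar_dist_sq_le (hr k) (hr' k) _ _

theorem klDiv_mraLaw_le_of_isPolar {σ : ℝ} (hσ : 0 < σ) (h : IsPolar θ r φ)
    (h' : IsPolar θ' r' φ') (hr : ∀ k, 0 ≤ r k) (hr' : ∀ k, 0 ≤ r' k) :
    klDiv (mraLaw σ θ) (mraLaw σ θ') ≤ ENNReal.ofReal
      (Real.exp (maxEnergy r r' / (2 * σ ^ 2)) / (4 * σ ^ 4) * ∑ k, (r k ^ 2 - r' k ^ 2) ^ 2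
        + 3 * maxMagnitude r r' ^ 2 * maxEnergy r r'
            * Real.exp (3 * maxEnergy r r' / (2 * σ ^ 2)) / (2 * σ ^ 6)
          * ∑ k, ((r k - r' k) ^ 2 + r k * r' k * (φ k - φ' k) ^ 2)) := by
  have hE := maxEnergy_nonneg r r'
  have hdist := h.norm_sub_sq_le h' hr hr'
  have hD := (sq_nonneg ‖θ - θ'‖).trans hdist
  have hkl := klDiv_mraLaw_le_of_bandEnergy_le hσ (sq_nonneg (maxMagnitude r r'))
    (fun k => (h.bandEnergy_eq k).trans_le
      (pow_le_pow_left₀ (hr k) (le_maxMagnitude_left r r' k) 2))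
    (fun k => (h'.bandEnergy_eq k).trans_le
      (pow_le_pow_left₀ (hr' k) (le_maxMagnitude_right r r' k) 2))
    (T := maxEnergy r r')
    (by simpa only [maxEnergy, norm_sq_eq_sum_bandEnergy, h.bandEnergy_eq] using le_max_left _ _)
    (by simpa only [maxEnergy, norm_sq_eq_sum_bandEnergy, h'.bandEnergy_eq] using le_max_right _ _)
  simp only [h.bandEnergy_eq, h'.bandEnergy_eq] at hkl
  refine hkl.trans (ENNReal.ofReal_le_ofReal ?_)
  set E := maxEnergy r r'
  set M := maxMagnitude r r'
  set D := ∑ k, ((r k - r' k) ^ 2 + r k * r' k * (φ k - φ' k) ^ 2)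
  have hexp : Real.exp (3 * E / (2 * σ ^ 2))
      = Real.exp (E / (2 * σ ^ 2)) * Real.exp (E / σ ^ 2) := by
    rw [← Real.exp_add]
    congr 1
    field_simp
    ring
  have hcoef : 3 * M ^ 2 * E * Real.exp (E / σ ^ 2) / (4 * σ ^ 6) * ‖θ - θ'‖ ^ 2
      ≤ 3 * M ^ 2 * E * Real.exp (E / σ ^ 2) / (2 * σ ^ 6) * D := by
    gcongr
    norm_num
  rw [hexp]
  refine (mul_le_mul_of_nonneg_left (add_le_add_right hcoef _) (Real.exp_pos _).le).trans_eq ?_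
  ring

theorem le_ofReal_add_mul_iInf {ι : Type*} [Nonempty ι] {x : ENNReal} {a b : ℝ} {f : ι → ℝ}
    (hb : 0 ≤ b) (hf : BddBelow (Set.range f)) (h : ∀ i, x ≤ ENNReal.ofReal (a + b * f i)) :
    x ≤ ENNReal.ofReal (a + b * ⨅ i, f i) := by
  have hmono : Monotone fun s : ℝ => ENNReal.ofReal (a + b * s) := fun s t hst =>
    ENNReal.ofReal_le_ofReal (add_le_add_right (mul_le_mul_of_nonneg_left hst hb) a)
  have hcont : Continuous fun s : ℝ => ENNReal.ofReal (a + b * s) :=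
    ENNReal.continuous_ofReal.comp (by fun_prop)
  rw [hmono.map_ciInf_of_continuousAt hcont.continuousAt hf]
  exact le_ciInf h

end Polar

end

theorem lemma12 (K : ℕ) (hK : 1 ≤ K) (σ : ℝ) (hσ : 0 < σ)
    (θ θ' : EuclideanSpace ℝ (Fin K × Fin 2)) :
    klDiv (mraLaw σ θ) (mraLaw σ θ') ≤ ENNReal.ofReal (‖θ - θ'‖ ^ 2 / (2 * σ ^ 2)) ∧
    ∀ r φ r' φ' : Fin K → ℝ,
      (∀ k, 0 ≤ r k) → (∀ k, 0 ≤ r' k) →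
      (∀ k, θ (k, 0) = r k * Real.cos (φ k) ∧ θ (k, 1) = r k * Real.sin (φ k)) →
      (∀ k, θ' (k, 0) = r' k * Real.cos (φ' k) ∧ θ' (k, 1) = r' k * Real.sin (φ' k)) →
      klDiv (mraLaw σ θ) (mraLaw σ θ') ≤ ENNReal.ofReal
        (Real.exp (maxEnergy r r' / (2 * σ ^ 2)) / (4 * σ ^ 4)
            * ∑ k, (r k ^ 2 - r' k ^ 2) ^ 2
          + 3 * maxMagnitude r r' ^ 2 * maxEnergy r r'
              * Real.exp (3 * maxEnergy r r' / (2 * σ ^ 2)) / (2 * σ ^ 6)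
            * ⨅ α : ℝ, ∑ k : Fin K,
                ((r k - r' k) ^ 2
                  + r k * r' k * (φ k - φ' k + ((k : ℕ) + 1 : ℝ) * α) ^ 2)) := by
  refine ⟨klDiv_mraLaw_le_norm_sub_sq hσ θ θ', fun r φ r' φ' hr hr' hθ hθ' => ?_⟩
  have hE := maxEnergy_nonneg r r'
  have hbdd : BddBelow (Set.range fun α : ℝ => ∑ k : Fin K, ((r k - r' k) ^ 2
      + r k * r' k * (φ k - φ' k + ((k : ℕ) + 1 : ℝ) * α) ^ 2)) :=
    ⟨0, Set.forall_mem_range.2 fun α => Finset.sum_nonneg fun k _ =>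
      add_nonneg (sq_nonneg _) (mul_nonneg (mul_nonneg (hr k) (hr' k)) (sq_nonneg _))⟩
  refine le_ofReal_add_mul_iInf (by positivity) hbdd fun α => ?_
  have halign := klDiv_mraLaw_le_of_isPolar hσ (IsPolar.mraRot hθ α) hθ' hr hr'
  simpa only [mraLaw_mraRot, add_sub_right_comm] using halign
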